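/- **Conventions.** A complex structure $J$ on a smooth manifold is an integrable almost complex structure. For a Hermitian manifold $(M,g,J)$ put $\omega=g(J\cdot,\cdot)$ and $d^c\omega=-J\,d\omega$, i.e. $d^c\omega(X,Y,Z)=-d\omega(JX,JY,JZ)$; it is Kähler if $d\omega=0$. A generalized Kähler structure on $M$ is a triple $(h,I_+,I_-)$ of a Riemannian metric $h$ and two complex structures $I_\pm$ compatible with $h$ such that, with $\omega_\pm=h(I_\pm\cdot,\cdot)$, $d^c_+\omega_+=-d^c_-\omega_-$ and $dd^c_+\omega_+=0$. **Theorem.** Let $G$ be a compact, connected and simply connected semisimple Lie group with $\dim G\ge 3$ and with a bi-invariant metric $b$. Let $G'=G\times\mathbb R^n$ be the product Lie group with the bi-invariant metric $g'=b+g_E$, where $g_E$ is the Euclidean metric on $\mathbb R^n$, and let $J_L$ and $J_R$ be a left-invariant and a right-invariant complex structure on $G'$, both compatible with $g'$. Let $\rho:\mathbb Z^n\to \mathrm{Isom}(G)=\mathrm{Isom}(G,b)$ be a group homomorphism such that for each $m\in\mathbb Z^n$ the diffeomorphism $(q,t)\mapsto(\rho(m)q,t+m)$ of $G'$ is holomorphic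 with respect to $J_L$ and with respect to $J_R$. Let $(K,g,J)$ be a compact Kähler manifold and let $\psi:\mathbb Z^n\to\mathrm{Isom}_{hol}(K)$ be a group homomorphism into the group of holomorphic isometries of $(K,g,J)$. Then $\mathbb Z^n$ acts freely and properly discontinuously on $K\times G\times\mathbb R^n$ by $$m\cdot(p,q,t)=(\psi(m)p,\rho(m)q,t+m),$$ and the quotient $M_{\psi,\rho}=(K\times G\times\mathbb R^n)/\mathbb Z^n$ is a (Hausdorff, second countable) smooth manifold, with the projection $\pi:K\times G\times\mathbb R^n\to M_{\psi,\rho}$ a local diffeomorphism, which admits a generalized Kähler structure $(h,I_+,I_-)$ induced by $g+b+g_E$, $J\times J_R$ and $J\times J_L$; that is, $\pi^*h=g+b+g_E$, $d\pi\circ(J\times J_R)=I_+\circ d\pi$ and $d\pi\circ(J\times J_L)=I_-\circ d\pi$. -/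

import Mathlib

open scoped Manifold ContDiff Topology
open Bundle

noncomputable section

/-! ### Tensor fields and differential forms on a manifold -/

section Tensors

variable {E : Type*} [NormedAddCommGroup E] [NormedSpace ℝ E]
  {H : Type*} [TopologicalSpace H] (I : ModelWithCorners ℝ E H)
  (M : Type*) [TopologicalSpace M] [ChartedSpace H M]
  {E' : Type*} [NormedAddCommGroup E'] [NormedSpace ℝ E']
  {H' : Type*} [TopologicalSpace H'] (I' : ModelWithCorners ℝ E' H')
  (M' : Type*) [TopologicalSpace M'] [ChartedSpace H' M']

/-- Fields of endomorphisms of the tangent spaces (no regularity imposed). -/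
abbrev EndField : Type _ := ∀ x : M, TangentSpace I x →L[ℝ] TangentSpace I x

/-- Fields of bilinear forms on the tangent spaces (no regularity imposed). -/
abbrev BilinField : Type _ := ∀ x : M, TangentSpace I x →L[ℝ] TangentSpace I x →L[ℝ] ℝ

/-- Fields of alternating `k`-forms on the tangent spaces (no regularity imposed). -/
abbrev FormField (k : ℕ) : Type _ := ∀ x : M, TangentSpace I x [⋀^Fin k]→L[ℝ] ℝ

/-- Smooth Riemannian metrics on `M`. -/
abbrev SmoothMetric [IsManifold I ∞ M] : Type _ :=
  ContMDiffRiemannianMetric I ∞ E (fun x : M => TangentSpace I x)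

variable {I M I' M'}

/-- `f^* g' = g`. -/
def PullsBackMetric (f : M → M') (g : BilinField I M) (g' : BilinField I' M') : Prop :=
  ∀ (x : M) (u v : TangentSpace I x),
    g' (f x) (mfderiv I I' f x u) (mfderiv I I' f x v) = g x u v

/-- `df ∘ J = J' ∘ df`: for complex structures `J` and `J'`, the map `f` is holomorphic. -/
def Intertwines (f : M → M') (J : EndField I M) (J' : EndField I' M') : Prop :=
  ∀ (x : M) (u : TangentSpace I x), mfderiv I I' f x (J x u) = J' (f x) (mfderiv I I' f x u)

/-- The product `J × J'` on `T(M × M') = TM × TM'`. -/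
def prodEnd (J : EndField I M) (J' : EndField I' M') : EndField (I.prod I') (M × M') :=
  fun x => (J x.1).prodMap (J' x.2)

/-- The product `g + g'` on `T(M × M') = TM × TM'`. -/
def prodBilin (g : BilinField I M) (g' : BilinField I' M') : BilinField (I.prod I') (M × M') :=
  fun x =>
    letI B : E →L[ℝ] E →L[ℝ] ℝ := g x.1
    letI B' : E' →L[ℝ] E' →L[ℝ] ℝ := g' x.2
    (B.bilinearComp (ContinuousLinearMap.fst ℝ E E') (ContinuousLinearMap.fst ℝ E E') +
      B'.bilinearComp (ContinuousLinearMap.snd ℝ E E') (ContinuousLinearMap.snd ℝ E E') :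
      E × E' →L[ℝ] E × E' →L[ℝ] ℝ)

/-- The expression of a `k`-form in the preferred chart at `x₀`: its pullback under the inverse
of that chart. -/
def FormField.inChart {k : ℕ} (α : FormField I M k) (x₀ : M) (y : E) : E [⋀^Fin k]→L[ℝ] ℝ :=
  (α ((extChartAt I x₀).symm y)).compContinuousLinearMap
    (mfderivWithin 𝓘(ℝ, E) I (extChartAt I x₀).symm (Set.range I) y)

/-- The exterior derivative, computed at each point `x` in the preferred chart at `x` (for smooth
forms any other chart gives the same result). -/
def FormField.d {k : ℕ} (α : FormField I M k) : FormField I M (k + 1) := fun x =>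
  (extDerivWithin (α.inChart x) (Set.range I) (extChartAt I x x)).compContinuousLinearMap
    (mfderiv I 𝓘(ℝ, E) (extChartAt I x) x)

/-- `J` is a complex structure: a smooth field of endomorphisms with `J² = -1` which is integrable,
i.e. near every point there are smooth coordinates with values in some `ℂ^r` whose differential
carries `J` to the multiplication by `i`. -/
structure IsComplexStructure [IsManifold I ∞ M] (J : EndField I M) : Prop where
  smooth : ContMDiff I (I.prod 𝓘(ℝ, E →L[ℝ] E)) ∞
    (fun x : M => TotalSpace.mk' (E →L[ℝ] E)
      (E := fun x : M => TangentSpace I x →L[ℝ] TangentSpace I x) x (J x))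
  sq : ∀ (x : M) (u : TangentSpace I x), J x (J x u) = -u
  integrable : ∀ x : M, ∃ (r : ℕ)
    (φ : PartialDiffeomorph I 𝓘(ℝ, Fin r → ℂ) M (Fin r → ℂ) ∞),
    x ∈ φ.source ∧ ∀ y ∈ φ.source, ∀ (u : TangentSpace I y) (j : Fin r),
      (mfderiv I 𝓘(ℝ, Fin r → ℂ) φ y (J y u) : Fin r → ℂ) j =
        Complex.I * (mfderiv I 𝓘(ℝ, Fin r → ℂ) φ y u : Fin r → ℂ) j

/-- `g(Ju, Jv) = g(u, v)`. -/
def IsCompatible (g : BilinField I M) (J : EndField I M) : Prop :=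
  ∀ (x : M) (u v : TangentSpace I x), g x (J x u) (J x v) = g x u v

end Tensors

/-! ### Hermitian, Kähler and generalized Kähler structures -/

section Hermitian

variable {E : Type*} [NormedAddCommGroup E] [NormedSpace ℝ E]
  {H : Type*} [TopologicalSpace H] (I : ModelWithCorners ℝ E H)
  (M : Type*) [TopologicalSpace M] [ChartedSpace H M] [IsManifold I ∞ M]

/-- A Hermitian structure `(g, J)`. -/
structure HermitianStructure where
  metric : SmoothMetric I M
  J : EndField I M
  isComplex : IsComplexStructure J
  compatible : IsCompatible metric.inner J

variable {I M}

namespace HermitianStructure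

variable (S : HermitianStructure I M)

lemma metric_J_self (x : M) (u : TangentSpace I x) : S.metric.inner x (S.J x u) u = 0 := by
  have h := S.compatible x (S.J x u) u
  rw [S.isComplex.sq, map_neg, _root_.neg_apply, S.metric.symm] at h
  linarith

/-- The fundamental form `ω(u, v) = g(Ju, v)`. -/
def fundamentalForm : FormField I M 2 := fun x =>
  { toFun := fun v => S.metric.inner x (S.J x (v 0)) (v 1)
    map_update_add' := by
      intro inst v i a b
      obtain rfl : inst = instDecidableEqFin 2 := Subsingleton.elim _ _
      fin_cases i <;> simp [Function.update]
    map_update_smul' := by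
      intro inst v i c a
      obtain rfl : inst = instDecidableEqFin 2 := Subsingleton.elim _ _
      fin_cases i <;> simp [Function.update]
    cont := by fun_prop
    map_eq_zero_of_eq' := by
      intro v i j hij hne
      have h01 : v 0 = v 1 := by
        fin_cases i <;> fin_cases j <;> simp_all
      change S.metric.inner x (S.J x (v 0)) (v 1) = 0
      rw [← h01]
      exact S.metric_J_self x (v 0) }

/-- `d^c ω = -J dω`, i.e. `(d^c ω)(u, v, w) = -dω(Ju, Jv, Jw)`. -/
def dcOmega : FormField I M 3 := fun x =>
  -(S.fundamentalForm.d x).compContinuousLinearMap (S.J x)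

/-- The Hermitian structure is Kähler: `dω = 0`. -/
def IsKahler : Prop := S.fundamentalForm.d = 0

end HermitianStructure

variable (I M) in
/-- A generalized Kähler structure `(g, I₊, I₋)`: two Hermitian structures with the same metric,
such that `d^c₊ ω₊ = -d^c₋ ω₋` and `d d^c₊ ω₊ = 0`. -/
structure GeneralizedKahlerStructure where
  plus : HermitianStructure I M
  minus : HermitianStructure I M
  same_metric : plus.metric = minus.metric
  torsion_eq : plus.dcOmega = -minus.dcOmega
  torsion_closed : FormField.d plus.dcOmega = 0

/-- The group of (smooth) Riemannian isometries of `(M, g)`. -/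
def isomGroup (g : SmoothMetric I M) : Subgroup (Equiv.Perm M) where
  carrier := {f | ContMDiff I I ∞ f ∧ ContMDiff I I ∞ f.symm ∧
    PullsBackMetric f g.inner g.inner}
  one_mem' := by
    refine ⟨contMDiff_id, contMDiff_id, fun x u v => ?_⟩
    have : mfderiv I I ((1 : Equiv.Perm M) : M → M) x = ContinuousLinearMap.id ℝ _ := mfderiv_id
    rw [this]; rfl
  mul_mem' := by
    rintro f h ⟨hf, hf', hfg⟩ ⟨hh, hh', hhg⟩
    refine ⟨hf.comp hh, hh'.comp hf', fun x u v => ?_⟩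
    have : mfderiv I I ((f * h : Equiv.Perm M) : M → M) x =
        (mfderiv I I f (h x)).comp (mfderiv I I h x) :=
      mfderiv_comp x (hf.mdifferentiableAt (by simp)) (hh.mdifferentiableAt (by simp))
    rw [this]
    exact (hfg (h x) _ _).trans (hhg x u v)
  inv_mem' := by
    rintro f ⟨hf, hf', hfg⟩
    refine ⟨hf', hf, fun x u v => ?_⟩
    have key : ∀ w : TangentSpace I x,
        mfderiv I I f (f.symm x) (mfderiv I I f.symm x w) = w := by
      intro w
      have h1 := mfderiv_comp x (hf.mdifferentiableAt (x := f.symm x) (by simp))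
        (hf'.mdifferentiableAt (x := x) (by simp))
      have h2 : (f : M → M) ∘ f.symm = id := by ext y; simp
      rw [h2, mfderiv_id] at h1
      exact (congrArg (fun L => L w) h1).symm
    have h3 := hfg (f.symm x) (mfderiv I I f.symm x u) (mfderiv I I f.symm x v)
    rw [key, key] at h3
    refine h3.symm.trans ?_
    congr 1
    rw [Equiv.apply_symm_apply]

/-- The group of holomorphic isometries of a Hermitian manifold `(M, g, J)`. -/
def holIsomGroup (S : HermitianStructure I M) : Subgroup (Equiv.Perm M) where
  carrier := {f | f ∈ isomGroup S.metric ∧ Intertwines f S.J S.J}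
  one_mem' := by
    refine ⟨one_mem _, fun x u => ?_⟩
    have : mfderiv I I ((1 : Equiv.Perm M) : M → M) x = ContinuousLinearMap.id ℝ _ := mfderiv_id
    rw [this]; rfl
  mul_mem' := by
    rintro f h ⟨hf, hfJ⟩ ⟨hh, hhJ⟩
    refine ⟨mul_mem hf hh, fun x u => ?_⟩
    have : mfderiv I I ((f * h : Equiv.Perm M) : M → M) x =
        (mfderiv I I f (h x)).comp (mfderiv I I h x) :=
      mfderiv_comp x (hf.1.mdifferentiableAt (by simp)) (hh.1.mdifferentiableAt (by simp))
    rw [this]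
    exact (congrArg (mfderiv I I f (h x)) (hhJ x u)).trans (hfJ (h x) _)
  inv_mem' := by
    rintro f ⟨hf, hfJ⟩
    refine ⟨inv_mem hf, fun x u => ?_⟩
    have inv_left : ∀ (y : M) (w : TangentSpace I y),
        mfderiv I I f.symm (f y) (mfderiv I I f y w) = w := by
      intro y w
      have h1 := mfderiv_comp y (hf.2.1.mdifferentiableAt (x := f y) (by simp))
        (hf.1.mdifferentiableAt (x := y) (by simp))
      have h2 : (f.symm : M → M) ∘ f = id := by ext z; simp
      rw [h2, mfderiv_id] at h1
      exact (congrArg (fun L => L w) h1).symm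
    have inv_right : ∀ (y : M) (w : TangentSpace I (f y)),
        mfderiv I I f y (mfderiv I I f.symm (f y) w) = w := by
      intro y w
      have h1 := mfderiv_comp (f y) (hf.1.mdifferentiableAt (x := f.symm (f y)) (by simp))
        (hf.2.1.mdifferentiableAt (x := f y) (by simp))
      have h2 : (f : M → M) ∘ f.symm = id := by ext z; simp
      rw [h2, mfderiv_id, Equiv.symm_apply_apply] at h1
      exact (congrArg (fun L => L w) h1).symm
    obtain ⟨y, rfl⟩ := f.surjective x
    change mfderiv I I f.symm (f y) (S.J (f y) u) =
      S.J (f.symm (f y)) (mfderiv I I f.symm (f y) u)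
    have h3 := hfJ y (mfderiv I I f.symm (f y) u)
    rw [inv_right] at h3
    rw [← h3, inv_left, Equiv.symm_apply_apply]

end Hermitian

/-! ### The quotient of `K × G × ℝⁿ` by `ℤⁿ` -/

/-- The Euclidean metric on `ℝⁿ`. -/
def euclideanBilin (n : ℕ) :
    BilinField 𝓘(ℝ, EuclideanSpace ℝ (Fin n)) (EuclideanSpace ℝ (Fin n)) :=
  fun _ => (innerSL ℝ : EuclideanSpace ℝ (Fin n) →L[ℝ] EuclideanSpace ℝ (Fin n) →L[ℝ] ℝ)

/-- The inclusion `ℤⁿ → ℝⁿ`; the group `ℤⁿ` is written multiplicatively. -/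
def latticeVec {n : ℕ} (m : Multiplicative (Fin n → ℤ)) : EuclideanSpace ℝ (Fin n) :=
  WithLp.toLp 2 fun i => ((Multiplicative.toAdd m i : ℤ) : ℝ)

section LieGroup

variable {E : Type*} [NormedAddCommGroup E] [NormedSpace ℝ E]
  {H : Type*} [TopologicalSpace H] (I : ModelWithCorners ℝ E H)
  (G : Type*) [TopologicalSpace G] [ChartedSpace H G] [Group G]

/-- The Lie group `G` is semisimple: its Lie algebra is. -/
def IsSemisimpleLieGroup [FiniteDimensional ℝ E] [LieGroup I ∞ G] : Prop :=
  haveI : CompleteSpace E := FiniteDimensional.complete ℝ E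
  haveI : LieGroup I (minSmoothness ℝ 3) G := LieGroup.of_le (n := ∞) (by
    rw [minSmoothness_of_isRCLikeNormedField]
    exact ENat.LEInfty.out)
  LieAlgebra.IsSemisimple ℝ (GroupLieAlgebra I G)

variable {G}

/-- The metric `b` on `G` is bi-invariant: left and right translations are isometries. -/
def IsBiInvariantMetric (b : BilinField I G) : Prop :=
  ∀ a : G, PullsBackMetric (I := I) (I' := I) (fun x => a * x) b b ∧
    PullsBackMetric (I := I) (I' := I) (fun x => x * a) b b

variable {n : ℕ} {I}

/-- `J` is invariant under the left translations of the Lie group `G × ℝⁿ`. -/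
def IsLeftInvariant
    (J : EndField (I.prod 𝓘(ℝ, EuclideanSpace ℝ (Fin n))) (G × EuclideanSpace ℝ (Fin n))) :
    Prop :=
  ∀ a : G × EuclideanSpace ℝ (Fin n), Intertwines (fun x => (a.1 * x.1, a.2 + x.2)) J J

/-- `J` is invariant under the right translations of the Lie group `G × ℝⁿ`. -/
def IsRightInvariant
    (J : EndField (I.prod 𝓘(ℝ, EuclideanSpace ℝ (Fin n))) (G × EuclideanSpace ℝ (Fin n))) :
    Prop :=
  ∀ a : G × EuclideanSpace ℝ (Fin n), Intertwines (fun x => (x.1 * a.1, x.2 + a.2)) J J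

end LieGroup

section Quotient

variable {K G : Type*} {n : ℕ} {A : Subgroup (Equiv.Perm K)} {B : Subgroup (Equiv.Perm G)}

/-- The action of `ℤⁿ` on `K × G × ℝⁿ` by `m • (p, q, t) = (ψ(m) p, ρ(m) q, t + m)`. -/
abbrev latticeAction (ψ : Multiplicative (Fin n → ℤ) →* A)
    (ρ : Multiplicative (Fin n → ℤ) →* B) :
    MulAction (Multiplicative (Fin n → ℤ)) (K × G × EuclideanSpace ℝ (Fin n)) where
  smul m x := ((ψ m : Equiv.Perm K) x.1, (ρ m : Equiv.Perm G) x.2.1, x.2.2 + latticeVec m)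
  one_smul x := by
    refine Prod.ext ?_ (Prod.ext ?_ ?_)
    · change (ψ 1 : Equiv.Perm K) x.1 = x.1
      simp
    · change (ρ 1 : Equiv.Perm G) x.2.1 = x.2.1
      simp
    · change x.2.2 + latticeVec 1 = x.2.2
      ext i; simp [latticeVec]
  mul_smul m m' x := by
    refine Prod.ext ?_ (Prod.ext ?_ ?_)
    · change (ψ (m * m') : Equiv.Perm K) x.1 = (ψ m : Equiv.Perm K) ((ψ m' : Equiv.Perm K) x.1)
      simp
    · change (ρ (m * m') : Equiv.Perm G) x.2.1 =
        (ρ m : Equiv.Perm G) ((ρ m' : Equiv.Perm G) x.2.1)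
      simp
    · change x.2.2 + latticeVec (m * m') = x.2.2 + latticeVec m' + latticeVec m
      ext i; simp [latticeVec]; ring

/-- The quotient `M_{ψ,ρ} = (K × G × ℝⁿ) / ℤⁿ`. -/
def LatticeQuotient (ψ : Multiplicative (Fin n → ℤ) →* A)
    (ρ : Multiplicative (Fin n → ℤ) →* B) : Type _ :=
  letI := latticeAction ψ ρ
  MulAction.orbitRel.Quotient (Multiplicative (Fin n → ℤ)) (K × G × EuclideanSpace ℝ (Fin n))

/-- The projection `K × G × ℝⁿ → M_{ψ,ρ}`. -/
def LatticeQuotient.mk (ψ : Multiplicative (Fin n → ℤ) →* A)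
    (ρ : Multiplicative (Fin n → ℤ) →* B) (x : K × G × EuclideanSpace ℝ (Fin n)) :
    LatticeQuotient ψ ρ :=
  letI := latticeAction ψ ρ
  Quotient.mk (MulAction.orbitRel (Multiplicative (Fin n → ℤ))
    (K × G × EuclideanSpace ℝ (Fin n))) x

/-- The quotient topology. -/
instance [TopologicalSpace K] [TopologicalSpace G] (ψ : Multiplicative (Fin n → ℤ) →* A)
    (ρ : Multiplicative (Fin n → ℤ) →* B) : TopologicalSpace (LatticeQuotient ψ ρ) :=
  TopologicalSpace.coinduced (LatticeQuotient.mk ψ ρ) inferInstance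

end Quotient

end

/-!
In a frame adapted to an integrable `J`, the Chevalley–Eilenberg formula and the vanishing of the
Nijenhuis tensor express `d^c ω` through the brackets of the frame. On a Lie group with a
bi-invariant metric `g` this gives `d^c ω (u, v, w) = g([u, v], w)`, both for a left-invariant `J`
in the left-invariant frame and for a right-invariant `J` in the right-invariant frame. The brackets
of these two frames are opposite at a point where the frames agree, so `d^c ω_R = -d^c ω_L`,
whatever `J_L` and `J_R` are.

Up to sign this form is both left- and right-invariant. The map `y ↦ x y⁻¹ x` fixes `x` with
differential `-1` and is the inversion up to translations, so it changes the sign of a bi-invariant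
form `α` of odd degree; as `d` commutes with pullback it also changes the sign of `dα`, which has
even degree and is therefore preserved at `x`. Hence `dα = 0`.

A Kähler factor adds nothing to `d^c ω`. So `K × G × ℝⁿ` is generalized Kähler, and `ℤⁿ` acts on it
by automorphisms of this structure, freely and properly discontinuously because it translates the
factor `ℝⁿ`. The structure descends to the quotient because pullback along a surjective local
diffeomorphism is injective on forms and commutes with `d`.
-/

noncomputable section

/-! ### Tensor fields in charts -/

section ModelSpace

variable {E : Type*} [NormedAddCommGroup E] [NormedSpace ℝ E]
  {H : Type*} [TopologicalSpace H] {I : ModelWithCorners ℝ E H}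
  {M : Type*} [TopologicalSpace M] [ChartedSpace H M]
  {E' : Type*} [NormedAddCommGroup E'] [NormedSpace ℝ E']
  {H' : Type*} [TopologicalSpace H'] {I' : ModelWithCorners ℝ E' H'}
  {M' : Type*} [TopologicalSpace M'] [ChartedSpace H' M']

/-- The value of a field of endomorphisms at a point, typed on the model space `E` instead of the
definitionally equal tangent space, so that values at different points can be compared. -/
def EndField.val (J : EndField I M) (x : M) : E →L[ℝ] E := J x

/-- The value of a field of bilinear forms at a point, typed on the model space. -/
def BilinField.val (g : BilinField I M) (x : M) : E →L[ℝ] E →L[ℝ] ℝ := g x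

/-- The value of a form at a point, typed on the model space. -/
def FormField.val {k : ℕ} (α : FormField I M k) (x : M) : E [⋀^Fin k]→L[ℝ] ℝ := α x

/-- The differential of `f` at `x`, typed as a map between the model spaces. -/
def diffAt (I : ModelWithCorners ℝ E H) (I' : ModelWithCorners ℝ E' H') (f : M → M') (x : M) :
    E →L[ℝ] E' :=
  mfderiv I I' f x

/-- The coordinate frame of the preferred chart at `x₀`, at the point with coordinates `y`: the
differential of the inverse chart, typed on the model space. -/
def frameAt (I : ModelWithCorners ℝ E H) {M : Type*} [TopologicalSpace M] [ChartedSpace H M]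
    (x₀ : M) (y : E) : E →L[ℝ] E :=
  mfderivWithin 𝓘(ℝ, E) I (extChartAt I x₀).symm (Set.range I) y

/-- The coordinate coframe of the preferred chart at `x₀`, at the point `x`: the differential of
the chart, typed on the model space. -/
def coframeAt (I : ModelWithCorners ℝ E H) {M : Type*} [TopologicalSpace M] [ChartedSpace H M]
    (x₀ : M) (x : M) : E →L[ℝ] E :=
  mfderiv I 𝓘(ℝ, E) (extChartAt I x₀) x

/-- The pullback `f^* α`. -/
def FormField.pullback {k : ℕ} (f : M → M') (α : FormField I' M' k) : FormField I M k :=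
  fun x => (α (f x)).compContinuousLinearMap (mfderiv I I' f x)

/-- Differentiability of a form, tested at each point in the preferred chart there. -/
def FormField.IsDifferentiable {k : ℕ} (α : FormField I M k) : Prop :=
  ∀ x : M, DifferentiableAt ℝ (α.inChart x) (extChartAt I x x)

/-- The expression of a field of endomorphisms in the preferred chart at `x₀`. -/
def EndField.inChart (J : EndField I M) (x₀ : M) (y : E) : E →L[ℝ] E :=
  (coframeAt I x₀ ((extChartAt I x₀).symm y)).comp
    ((J.val ((extChartAt I x₀).symm y)).comp (frameAt I x₀ y))

/-- The expression of a field of bilinear forms in the preferred chart at `x₀`. -/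
def BilinField.inChart (g : BilinField I M) (x₀ : M) (y : E) : E →L[ℝ] E →L[ℝ] ℝ :=
  (g.val ((extChartAt I x₀).symm y)).bilinearComp (frameAt I x₀ y) (frameAt I x₀ y)

lemma FormField.ext_val {k : ℕ} {α β : FormField I M k}
    (h : ∀ x (v : Fin k → E), α.val x v = β.val x v) : α = β :=
  funext fun x => ContinuousAlternatingMap.ext (h x)

lemma FormField.inChart_apply {k : ℕ} (α : FormField I M k) (x₀ : M) (y : E) (v : Fin k → E) :
    α.inChart x₀ y v = α.val ((extChartAt I x₀).symm y) (fun i => frameAt I x₀ y (v i)) := rfl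

lemma FormField.pullback_apply {k : ℕ} (f : M → M') (α : FormField I' M' k) (x : M)
    (v : Fin k → E) :
    (α.pullback (I := I) f).val x v = α.val (f x) (fun i => diffAt I I' f x (v i)) := rfl

lemma prodBilin_val (g : BilinField I M) (g' : BilinField I' M') (x : M × M') (u v : E × E') :
    (prodBilin g g').val x u v = g.val x.1 u.1 v.1 + g'.val x.2 u.2 v.2 := rfl

lemma Intertwines.val {f : M → M'} {J : EndField I M} {J' : EndField I' M'}
    (h : Intertwines f J J') (x : M) (u : E) :
    diffAt I I' f x (J.val x u) = J'.val (f x) (diffAt I I' f x u) := h x u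

lemma PullsBackMetric.val {f : M → M'} {g : BilinField I M} {g' : BilinField I' M'}
    (h : PullsBackMetric f g g') (x : M) (u v : E) :
    g'.val (f x) (diffAt I I' f x u) (diffAt I I' f x v) = g.val x u v := h x u v

lemma diffAt_comp {E'' : Type*} [NormedAddCommGroup E''] [NormedSpace ℝ E'']
    {H'' : Type*} [TopologicalSpace H''] {I'' : ModelWithCorners ℝ E'' H''}
    {M'' : Type*} [TopologicalSpace M''] [ChartedSpace H'' M'']
    {g : M' → M''} {f : M → M'} {x : M} (hg : MDifferentiableAt I' I'' g (f x))
    (hf : MDifferentiableAt I I' f x) :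
    diffAt I I'' (fun z => g (f z)) x = (diffAt I' I'' g (f x)).comp (diffAt I I' f x) :=
  mfderiv_comp x hg hf

lemma diffAt_congr {f g : M → M'} {x : M} (h : f =ᶠ[𝓝 x] g) :
    diffAt I I' f x = diffAt I I' g x := h.mfderiv_eq

lemma diffAt_id (x : M) : diffAt I I (fun z : M => z) x = ContinuousLinearMap.id ℝ E :=
  mfderiv_id

lemma diffAt_fst (x : M × M') : diffAt (I.prod I') I Prod.fst x = ContinuousLinearMap.fst ℝ E E' :=
  mfderiv_fst

lemma diffAt_snd (x : M × M') :
    diffAt (I.prod I') I' Prod.snd x = ContinuousLinearMap.snd ℝ E E' :=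
  mfderiv_snd

variable (I I') in
/-- The expression of `f` in the preferred charts at `x₀` and `f x₀`. -/
def chartMap (f : M → M') (x₀ : M) (y : E) : E' :=
  extChartAt I' (f x₀) (f ((extChartAt I x₀).symm y))

lemma chartMap_self (f : M → M') (x₀ : M) :
    chartMap I I' f x₀ (extChartAt I x₀ x₀) = extChartAt I' (f x₀) (f x₀) := by
  rw [chartMap, (extChartAt I x₀).left_inv (mem_extChartAt_source x₀)]

variable (I I') in
/-- The point with coordinates `y` in the preferred chart at `x₀` is one where `f` is differentiable
and whose image lies in the preferred chart at `f x₀`: the points at which the differential of `f`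
can be computed from `chartMap`. -/
structure MDifferentiableInCharts (f : M → M') (x₀ : M) (y : E) : Prop where
  mem_target : y ∈ (extChartAt I x₀).target
  mdifferentiableAt : MDifferentiableAt I I' f ((extChartAt I x₀).symm y)
  map_mem_source : f ((extChartAt I x₀).symm y) ∈ (extChartAt I' (f x₀)).source

lemma MDifferentiableInCharts.extChartAt_symm_chartMap {f : M → M'} {x₀ : M} {y : E}
    (h : MDifferentiableInCharts I I' f x₀ y) :
    (extChartAt I' (f x₀)).symm (chartMap I I' f x₀ y) = f ((extChartAt I x₀).symm y) :=
  (extChartAt I' (f x₀)).left_inv h.map_mem_source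

lemma MDifferentiableInCharts.chartMap_mem_target {f : M → M'} {x₀ : M} {y : E}
    (h : MDifferentiableInCharts I I' f x₀ y) :
    chartMap I I' f x₀ y ∈ (extChartAt I' (f x₀)).target :=
  (extChartAt I' (f x₀)).map_source h.map_mem_source

end ModelSpace

section Charts

variable {E : Type*} [NormedAddCommGroup E] [NormedSpace ℝ E]
  {H : Type*} [TopologicalSpace H] {I : ModelWithCorners ℝ E H}
  {M : Type*} [TopologicalSpace M] [ChartedSpace H M] [IsManifold I ∞ M]

lemma coframeAt_comp_frameAt {x₀ : M} {y : E} (hy : y ∈ (extChartAt I x₀).target) (v : E) :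
    coframeAt I x₀ ((extChartAt I x₀).symm y) (frameAt I x₀ y v) = v :=
  congrArg (fun L : E →L[ℝ] E => L v)
    (mfderiv_extChartAt_comp_mfderivWithin_extChartAt_symm (I := I) hy)

lemma frameAt_comp_coframeAt {x₀ : M} {y : E} (hy : y ∈ (extChartAt I x₀).target) (v : E) :
    frameAt I x₀ y (coframeAt I x₀ ((extChartAt I x₀).symm y) v) = v :=
  congrArg (fun L : E →L[ℝ] E => L v)
    (mfderivWithin_extChartAt_symm_comp_mfderiv_extChartAt (I := I) hy)

lemma frameAt_self (x : M) (v : E) : frameAt I x (extChartAt I x x) v = v :=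
  congrArg (fun L : E →L[ℝ] E => L v) (mfderivWithin_range_extChartAt_symm (I := I) (x := x))

lemma coframeAt_self (x : M) (v : E) : coframeAt I x x v = v :=
  congrArg (fun L : E →L[ℝ] E => L v) (mfderiv_extChartAt_self (I := I) (x := x))

lemma mdifferentiableAt_extChartAt_of_mem {x₀ x : M} (hx : x ∈ (extChartAt I x₀).source) :
    MDifferentiableAt I 𝓘(ℝ, E) (extChartAt I x₀) x :=
  mdifferentiableAt_extChartAt (by rwa [extChartAt_source] at hx)

variable [I.Boundaryless]

lemma contMDiffAt_extChartAt_symm {x₀ : M} {y : E} (hy : y ∈ (extChartAt I x₀).target) :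
    ContMDiffAt 𝓘(ℝ, E) I ∞ (extChartAt I x₀).symm y :=
  (contMDiffOn_extChartAt_symm x₀).contMDiffAt ((isOpen_extChartAt_target x₀).mem_nhds hy)

lemma mdifferentiableAt_extChartAt_symm {x₀ : M} {y : E} (hy : y ∈ (extChartAt I x₀).target) :
    MDifferentiableAt 𝓘(ℝ, E) I (extChartAt I x₀).symm y :=
  (contMDiffAt_extChartAt_symm hy).mdifferentiableAt (by simp)

lemma tendsto_extChartAt_symm (x₀ : M) :
    Filter.Tendsto (extChartAt I x₀).symm (𝓝 (extChartAt I x₀ x₀)) (𝓝 x₀) := by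
  have hc := (contMDiffAt_extChartAt_symm (I := I) (mem_extChartAt_target x₀)).continuousAt
  rwa [ContinuousAt, (extChartAt I x₀).left_inv (mem_extChartAt_source x₀)] at hc

lemma contMDiffAt_comp_extChartAt_iff {F : Type*} [NormedAddCommGroup F] [NormedSpace ℝ F]
    {f : E → F} {x₀ : M} :
    ContMDiffAt I 𝓘(ℝ, F) ∞ (fun x => f (extChartAt I x₀ x)) x₀ ↔
      ContDiffAt ℝ ∞ f (extChartAt I x₀ x₀) := by
  refine ⟨fun hf => ?_, fun hf => (contMDiffAt_iff_contDiffAt.2 hf).comp x₀ contMDiffAt_extChartAt⟩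
  have hcomp : ContMDiffAt 𝓘(ℝ, E) 𝓘(ℝ, F) ∞
      (fun y => f (extChartAt I x₀ ((extChartAt I x₀).symm y))) (extChartAt I x₀ x₀) := by
    refine ContMDiffAt.comp (I' := I) (f := (extChartAt I x₀).symm)
      (g := fun x => f (extChartAt I x₀ x)) _ ?_
      (contMDiffAt_extChartAt_symm (mem_extChartAt_target x₀))
    rwa [(extChartAt I x₀).left_inv (mem_extChartAt_source x₀)]
  refine (contMDiffAt_iff_contDiffAt.1 hcomp).congr_of_eventuallyEq ?_
  filter_upwards [extChartAt_target_mem_nhds (I := I) x₀] with y hy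
  rw [(extChartAt I x₀).right_inv hy]

lemma EndField.contMDiffAt_iff {J : EndField I M} {x₀ : M} :
    ContMDiffAt I (I.prod 𝓘(ℝ, E →L[ℝ] E)) ∞
      (fun x : M => TotalSpace.mk' (E →L[ℝ] E)
        (E := fun x : M => TangentSpace I x →L[ℝ] TangentSpace I x) x (J x)) x₀ ↔
      ContDiffAt ℝ ∞ (J.inChart x₀) (extChartAt I x₀ x₀) := by
  rw [contMDiffAt_hom_bundle, ← contMDiffAt_comp_extChartAt_iff]
  refine (and_iff_right (contMDiffAt_id (I := I))).trans (Filter.EventuallyEq.contMDiffAt_iff ?_)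
  filter_upwards [(chartAt H x₀).open_source.mem_nhds (mem_chart_source H x₀)] with x hx
  rw [ContinuousLinearMap.inCoordinates, TangentBundle.continuousLinearMapAt_trivializationAt hx,
    TangentBundle.symmL_trivializationAt hx, EndField.inChart,
    (extChartAt I x₀).left_inv (by rwa [extChartAt_source])]
  rfl

lemma BilinField.contMDiffAt_iff {g : BilinField I M} {x₀ : M} :
    ContMDiffAt I (I.prod 𝓘(ℝ, E →L[ℝ] E →L[ℝ] ℝ)) ∞
      (fun x : M => TotalSpace.mk' (E →L[ℝ] E →L[ℝ] ℝ)
        (E := fun x : M => TangentSpace I x →L[ℝ] TangentSpace I x →L[ℝ] ℝ) x (g x)) x₀ ↔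
      ContDiffAt ℝ ∞ (g.inChart x₀) (extChartAt I x₀ x₀) := by
  rw [contMDiffAt_hom_bundle, ← contMDiffAt_comp_extChartAt_iff]
  refine (and_iff_right (contMDiffAt_id (I := I))).trans (Filter.EventuallyEq.contMDiffAt_iff ?_)
  filter_upwards [(chartAt H x₀).open_source.mem_nhds (mem_chart_source H x₀)] with x hx
  have symm_eq_frameAt (w : E) : (trivializationAt E (TangentSpace I) x₀).symm x w =
      frameAt I x₀ (extChartAt I x₀ x) w :=
    ((trivializationAt E (TangentSpace I) x₀).symmL_apply (R := ℝ) hx w).symm.trans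
      (congrArg (fun L : E →L[ℝ] E => L w) (TangentBundle.symmL_trivializationAt (I := I) hx))
  ext u v
  refine (inCoordinates_apply_eq₂ (B := M) (F₁ := E) (F₂ := E) (F₃ := ℝ)
    (E₁ := fun x : M => TangentSpace I x) (E₂ := fun x : M => TangentSpace I x)
    (E₃ := Bundle.Trivial M ℝ) (x₀ := x₀) (ϕ := g x) (v := u) (w := v) hx hx (by simp)).trans ?_
  rw [symm_eq_frameAt, symm_eq_frameAt, BilinField.inChart,
    (extChartAt I x₀).left_inv (by rwa [extChartAt_source])]
  simp only [Trivial.fiberBundle_trivializationAt', Trivial.linearMapAt_trivialization,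
    LinearMap.id_coe, id_eq]
  rfl

end Charts

section FiniteDimensional

variable {P : Type*} [NormedAddCommGroup P] [NormedSpace ℝ P]
  {E : Type*} [NormedAddCommGroup E] [NormedSpace ℝ E] [FiniteDimensional ℝ E]
  {W : Type*} [NormedAddCommGroup W] [NormedSpace ℝ W] [FiniteDimensional ℝ W]
  {n : WithTop ℕ∞} {p : P}

lemma contDiffAt_of_injective_linearMap {V : Type*} [NormedAddCommGroup V] [NormedSpace ℝ V]
    {S : Type*} [Finite S] (ev : V →ₗ[ℝ] (S → W)) (hinj : Function.Injective ev) {f : P → V}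
    (h : ∀ s, ContDiffAt ℝ n (fun y => ev (f y) s) p) : ContDiffAt ℝ n f p := by
  have := Fintype.ofFinite S
  obtain ⟨l, hl⟩ := ev.exists_leftInverse_of_injective (LinearMap.ker_eq_bot.2 hinj)
  have hf : f = fun y => l.toContinuousLinearMap (ev (f y)) :=
    funext fun y => (congrArg (fun L => L (f y)) hl).symm
  rw [hf]
  exact l.toContinuousLinearMap.contDiff.contDiffAt.comp p (contDiffAt_pi.2 h)

lemma contDiffAt_alternating_of_apply {k : ℕ} {f : P → E [⋀^Fin k]→L[ℝ] ℝ}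
    (h : ∀ v : Fin k → E, ContDiffAt ℝ n (fun y => f y v) p) : ContDiffAt ℝ n f p := by
  let bs := Module.finBasis ℝ E
  let ev : (E [⋀^Fin k]→L[ℝ] ℝ) →ₗ[ℝ] ((Fin k → Fin (Module.finrank ℝ E)) → ℝ) :=
    { toFun := fun α s => α fun i => bs (s i)
      map_add' := fun _ _ => rfl
      map_smul' := fun _ _ => rfl }
  refine contDiffAt_of_injective_linearMap ev (fun α β hαβ => ?_) fun s => h _
  exact ContinuousAlternatingMap.toAlternatingMap_injective
    (AlternatingMap.coe_multilinearMap_injective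
      (Module.Basis.ext_multilinear (fun _ => bs) fun s => congrFun hαβ s))

lemma contDiffAt_clm_of_apply {f : P → E →L[ℝ] W}
    (h : ∀ v : E, ContDiffAt ℝ n (fun y => f y v) p) : ContDiffAt ℝ n f p := by
  let bs := Module.finBasis ℝ E
  let ev : (E →L[ℝ] W) →ₗ[ℝ] (Fin (Module.finrank ℝ E) → W) :=
    { toFun := fun α s => α (bs s)
      map_add' := fun _ _ => rfl
      map_smul' := fun _ _ => rfl }
  refine contDiffAt_of_injective_linearMap ev (fun α β hαβ => ?_) fun s => h _
  exact ContinuousLinearMap.coe_injective (bs.ext fun s => congrFun hαβ s)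

lemma contDiffAt_bilin_of_apply {f : P → E →L[ℝ] E →L[ℝ] W}
    (h : ∀ u v : E, ContDiffAt ℝ n (fun y => f y u v) p) : ContDiffAt ℝ n f p :=
  contDiffAt_clm_of_apply fun u => contDiffAt_clm_of_apply (h u)

end FiniteDimensional

/-! ### Naturality of the exterior derivative -/

section Naturality

variable {F : Type*} [NormedAddCommGroup F] [NormedSpace ℝ F]
  {E : Type*} [NormedAddCommGroup E] [NormedSpace ℝ E]
  {H : Type*} [TopologicalSpace H] {I : ModelWithCorners ℝ E H} [I.Boundaryless]
  {M : Type*} [TopologicalSpace M] [ChartedSpace H M]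

lemma frameAt_eq_diffAt (x₀ : M) (y : E) :
    frameAt I x₀ y = diffAt 𝓘(ℝ, E) I (extChartAt I x₀).symm y := by
  rw [frameAt, diffAt, I.range_eq_univ, mfderivWithin_univ]

lemma FormField.d_apply {k : ℕ} (α : FormField I M k) (x : M) (v : Fin (k + 1) → E) :
    α.d.val x v =
      extDeriv (α.inChart x) (extChartAt I x x) (fun i => coframeAt I x x (v i)) := by
  rw [← extDerivWithin_univ, ← I.range_eq_univ]; rfl

lemma FormField.d_add {k : ℕ} {α β : FormField I M k} (hα : α.IsDifferentiable)
    (hβ : β.IsDifferentiable) : FormField.d (α + β) = α.d + β.d := by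
  refine FormField.ext_val fun x v => ?_
  refine (FormField.d_apply _ x v).trans (Eq.trans ?_
    (congrArg₂ (· + ·) (FormField.d_apply α x v) (FormField.d_apply β x v)).symm)
  have inChart_add : (α + β).inChart x = α.inChart x + β.inChart x := rfl
  rw [inChart_add, extDeriv_add (hα x) (hβ x)]
  rfl

variable [IsManifold I ∞ M]

lemma diffAt_eq_frameAt_comp_fderiv {f : F → M} {x₀ : M} {p : F}
    (hf : MDifferentiableAt 𝓘(ℝ, F) I f p) (hp : f p ∈ (extChartAt I x₀).source) :
    diffAt 𝓘(ℝ, F) I f p =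
      (frameAt I x₀ (extChartAt I x₀ (f p))).comp
        (fderiv ℝ (fun y => extChartAt I x₀ (f y)) p) := by
  have eventually_eq : f =ᶠ[𝓝 p] fun y => (extChartAt I x₀).symm (extChartAt I x₀ (f y)) := by
    filter_upwards [hf.continuousAt.preimage_mem_nhds
      ((isOpen_extChartAt_source x₀).mem_nhds hp)] with y hy
    exact ((extChartAt I x₀).left_inv hy).symm
  rw [diffAt_congr eventually_eq, diffAt_comp (g := (extChartAt I x₀).symm)
    (f := fun y => extChartAt I x₀ (f y))
    (mdifferentiableAt_extChartAt_symm ((extChartAt I x₀).map_source hp))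
    ((mdifferentiableAt_extChartAt_of_mem hp).comp p hf), frameAt_eq_diffAt]
  exact congrArg _ mfderiv_eq_fderiv

omit [I.Boundaryless] in
lemma fderiv_extChartAt_comp {f : F → M} {x₀ : M} {p : F}
    (hf : MDifferentiableAt 𝓘(ℝ, F) I f p) (hp : f p ∈ (extChartAt I x₀).source) :
    fderiv ℝ (fun y => extChartAt I x₀ (f y)) p =
      (coframeAt I x₀ (f p)).comp (diffAt 𝓘(ℝ, F) I f p) := by
  rw [← mfderiv_eq_fderiv]
  exact diffAt_comp (mdifferentiableAt_extChartAt_of_mem hp) hf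

lemma FormField.pullback_eventuallyEq_compContinuousLinearMap {k : ℕ} (α : FormField I M k)
    {f : F → M} {p : F} (hf : ContMDiffAt 𝓘(ℝ, F) I ∞ f p) :
    (fun y => (α.val (f y)).compContinuousLinearMap (diffAt 𝓘(ℝ, F) I f y)) =ᶠ[𝓝 p]
      fun y => (α.inChart (f p) (extChartAt I (f p) (f y))).compContinuousLinearMap
        (fderiv ℝ (fun z => extChartAt I (f p) (f z)) y) := by
  filter_upwards [hf.continuousAt.preimage_mem_nhds (extChartAt_source_mem_nhds (I := I) (f p)),
    (contMDiffAt_iff_contMDiffAt_nhds (by simp)).1 (hf.of_le (m := 1) (by simp))] with y hy hfy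
  ext w
  rw [ContinuousAlternatingMap.compContinuousLinearMap_apply,
    ContinuousAlternatingMap.compContinuousLinearMap_apply, FormField.inChart_apply,
    diffAt_eq_frameAt_comp_fderiv (hfy.mdifferentiableAt one_ne_zero) hy,
    (extChartAt I (f p)).left_inv hy]
  rfl

theorem FormField.extDeriv_pullback_normedSpace {k : ℕ} {α : FormField I M k} {f : F → M} {p : F}
    (hf : ContMDiffAt 𝓘(ℝ, F) I ∞ f p)
    (hα : DifferentiableAt ℝ (α.inChart (f p)) (extChartAt I (f p) (f p))) (v : Fin (k + 1) → F) :
    extDeriv (fun y => (α.val (f y)).compContinuousLinearMap (diffAt 𝓘(ℝ, F) I f y)) p v =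
      α.d.val (f p) (fun i => diffAt 𝓘(ℝ, F) I f p (v i)) := by
  have hchart : ContDiffAt ℝ ∞ (fun y => extChartAt I (f p) (f y)) p :=
    contMDiffAt_iff_contDiffAt.1 (contMDiffAt_extChartAt.comp p hf)
  rw [(α.pullback_eventuallyEq_compContinuousLinearMap hf).extDeriv_eq,
    extDeriv_pullback (f := fun y => extChartAt I (f p) (f y)) hα hchart
      (by rw [minSmoothness_of_isRCLikeNormedField]; exact ENat.LEInfty.out),
    ContinuousAlternatingMap.compContinuousLinearMap_apply, FormField.d_apply,
    fderiv_extChartAt_comp (hf.mdifferentiableAt (by simp)) (mem_extChartAt_source (f p))]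
  rfl

theorem FormField.inChart_d {k : ℕ} {α : FormField I M k} (hα : α.IsDifferentiable) {x₀ : M}
    {y : E} (hy : y ∈ (extChartAt I x₀).target) :
    α.d.inChart x₀ y = extDeriv (α.inChart x₀) y := by
  ext v
  rw [FormField.inChart_apply, frameAt_eq_diffAt,
    ← FormField.extDeriv_pullback_normedSpace (contMDiffAt_extChartAt_symm hy) (hα _) v]
  refine congrArg (fun θ => extDeriv θ y v) (funext fun y' => ?_)
  rw [← frameAt_eq_diffAt]
  rfl

variable {E' : Type*} [NormedAddCommGroup E'] [NormedSpace ℝ E']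
  {H' : Type*} [TopologicalSpace H'] {I' : ModelWithCorners ℝ E' H'}
  {M' : Type*} [TopologicalSpace M'] [ChartedSpace H' M']

lemma contDiffAt_chartMap {f : M → M'} {x₀ : M} (hf : ContMDiffAt I I' ∞ f x₀) :
    ContDiffAt ℝ ∞ (chartMap I I' f x₀) (extChartAt I x₀ x₀) := by
  rw [← contMDiffAt_iff_contDiffAt]
  refine ContMDiffAt.comp (I' := I) (f := (extChartAt I x₀).symm)
    (g := fun x => extChartAt I' (f x₀) (f x)) _ ?_
    (contMDiffAt_extChartAt_symm (mem_extChartAt_target x₀))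
  rw [(extChartAt I x₀).left_inv (mem_extChartAt_source x₀)]
  exact contMDiffAt_extChartAt.comp x₀ hf

variable [IsManifold I' ∞ M']

lemma eventually_mdifferentiableInCharts {f : M → M'} {x₀ : M} (hf : ContMDiffAt I I' ∞ f x₀) :
    ∀ᶠ y in 𝓝 (extChartAt I x₀ x₀), MDifferentiableInCharts I I' f x₀ y := by
  have hdiff : ∀ᶠ x in 𝓝 x₀, MDifferentiableAt I I' f x := by
    filter_upwards [(contMDiffAt_iff_contMDiffAt_nhds (by simp)).1
      (hf.of_le (m := 1) (by simp))] with x hx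
    exact hx.mdifferentiableAt one_ne_zero
  filter_upwards [extChartAt_target_mem_nhds (I := I) x₀,
    (tendsto_extChartAt_symm x₀).eventually hdiff,
    (tendsto_extChartAt_symm x₀).eventually
      (hf.continuousAt.preimage_mem_nhds (extChartAt_source_mem_nhds (I := I') (f x₀)))]
    with y hy hfy hmem
  exact ⟨hy, hfy, hmem⟩

variable [I'.Boundaryless]

theorem FormField.d_pullback {k : ℕ} {α : FormField I' M' k} (hα : α.IsDifferentiable)
    {f : M → M'} (hf : ContMDiff I I' ∞ f) :
    (α.pullback (I := I) f).d = α.d.pullback f := by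
  refine FormField.ext_val fun x v => ?_
  have diffAt_comp_symm {y : E} (hy : y ∈ (extChartAt I x).target) :
      diffAt 𝓘(ℝ, E) I' (fun y => f ((extChartAt I x).symm y)) y =
        (diffAt I I' f ((extChartAt I x).symm y)).comp (frameAt I x y) := by
    rw [diffAt_comp (hf.mdifferentiable (by simp) _) (mdifferentiableAt_extChartAt_symm hy),
      ← frameAt_eq_diffAt]
  have hd := FormField.extDeriv_pullback_normedSpace (α := α)
    (f := fun y => f ((extChartAt I x).symm y))
    (hf.contMDiffAt.comp _ (contMDiffAt_extChartAt_symm (mem_extChartAt_target x))) (hα _)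
    (fun i => coframeAt I x x (v i))
  refine (FormField.d_apply _ x v).trans (Eq.trans ?_ (hd.trans ?_))
  · refine congrArg (fun θ : E [⋀^Fin (k + 1)]→L[ℝ] ℝ => θ fun i => coframeAt I x x (v i))
      (Filter.EventuallyEq.extDeriv_eq ?_)
    filter_upwards [extChartAt_target_mem_nhds (I := I) x] with y hy
    ext w
    rw [FormField.inChart_apply, FormField.pullback_apply,
      ContinuousAlternatingMap.compContinuousLinearMap_apply, diffAt_comp_symm hy]
    rfl
  · rw [FormField.pullback_apply, diffAt_comp_symm (mem_extChartAt_target x),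
      (extChartAt I x).left_inv (mem_extChartAt_source x)]
    simp only [ContinuousLinearMap.comp_apply, frameAt_self, coframeAt_self]

lemma diffAt_comp_frameAt {f : M → M'} {x₀ : M} {y : E}
    (hy : MDifferentiableInCharts I I' f x₀ y) (v : E) :
    diffAt I I' f ((extChartAt I x₀).symm y) (frameAt I x₀ y v) =
      frameAt I' (f x₀) (chartMap I I' f x₀ y) (fderiv ℝ (chartMap I I' f x₀) y v) := by
  have hsymm := mdifferentiableAt_extChartAt_symm hy.mem_target
  have hchain := diffAt_eq_frameAt_comp_fderiv (f := fun y => f ((extChartAt I x₀).symm y))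
    (x₀ := f x₀) (p := y) (hy.mdifferentiableAt.comp y hsymm) hy.map_mem_source
  rw [diffAt_comp hy.mdifferentiableAt hsymm, ← frameAt_eq_diffAt] at hchain
  exact congrArg (fun L : E →L[ℝ] E' => L v) hchain

lemma fderiv_chartMap_self {f : M → M'} {x₀ : M} (hf : ContMDiffAt I I' ∞ f x₀) :
    fderiv ℝ (chartMap I I' f x₀) (extChartAt I x₀ x₀) = diffAt I I' f x₀ := by
  ext v
  have hchain := diffAt_comp_frameAt (eventually_mdifferentiableInCharts hf).self_of_nhds v
  rw [chartMap_self (I := I), frameAt_self, frameAt_self,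
    (extChartAt I x₀).left_inv (mem_extChartAt_source x₀)] at hchain
  exact hchain.symm

lemma BilinField.contDiffAt_inChart_of_pullback [FiniteDimensional ℝ E] {f : M → M'} {x₀ : M}
    (hf : ContMDiffAt I I' ∞ f x₀) {g : BilinField I M} {g' : BilinField I' M'}
    (hg' : ContDiffAt ℝ ∞ (g'.inChart (f x₀)) (extChartAt I' (f x₀) (f x₀)))
    (h : ∀ᶠ x in 𝓝 x₀, ∀ u v : E,
      g.val x u v = g'.val (f x) (diffAt I I' f x u) (diffAt I I' f x v)) :
    ContDiffAt ℝ ∞ (g.inChart x₀) (extChartAt I x₀ x₀) := by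
  refine contDiffAt_bilin_of_apply fun u v => ?_
  have hφ := contDiffAt_chartMap hf
  have hdφ := hφ.fderiv_right (m := ∞) (by simp)
  rw [← chartMap_self (I := I)] at hg'
  have hpullback : ContDiffAt ℝ ∞ (fun y => g'.inChart (f x₀) (chartMap I I' f x₀ y)
      (fderiv ℝ (chartMap I I' f x₀) y u) (fderiv ℝ (chartMap I I' f x₀) y v))
      (extChartAt I x₀ x₀) :=
    ((hg'.comp _ hφ).clm_apply (hdφ.clm_apply contDiffAt_const)).clm_apply
      (hdφ.clm_apply contDiffAt_const)
  refine hpullback.congr_of_eventuallyEq ?_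
  filter_upwards [eventually_mdifferentiableInCharts hf, (tendsto_extChartAt_symm x₀).eventually h]
    with y hy hgy
  rw [BilinField.inChart, BilinField.inChart, ContinuousLinearMap.bilinearComp_apply,
    ContinuousLinearMap.bilinearComp_apply, hgy, diffAt_comp_frameAt hy, diffAt_comp_frameAt hy,
    hy.extChartAt_symm_chartMap]

lemma EndField.inChart_intertwines {f : M → M'} {x₀ : M} {J : EndField I M}
    {J' : EndField I' M'} {y : E} (hy : MDifferentiableInCharts I I' f x₀ y)
    (h : ∀ u : E, diffAt I I' f ((extChartAt I x₀).symm y) (J.val ((extChartAt I x₀).symm y) u) =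
      J'.val (f ((extChartAt I x₀).symm y)) (diffAt I I' f ((extChartAt I x₀).symm y) u)) (u : E) :
    fderiv ℝ (chartMap I I' f x₀) y (J.inChart x₀ y u) =
      J'.inChart (f x₀) (chartMap I I' f x₀ y) (fderiv ℝ (chartMap I I' f x₀) y u) := by
  have hframe := h (frameAt I x₀ y u)
  rw [diffAt_comp_frameAt hy, ← frameAt_comp_coframeAt hy.mem_target (J.val _ _),
    diffAt_comp_frameAt hy] at hframe
  have hcoframe := congrArg (coframeAt I' (f x₀) (f ((extChartAt I x₀).symm y))) hframe
  rw [← hy.extChartAt_symm_chartMap,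
    coframeAt_comp_frameAt hy.chartMap_mem_target] at hcoframe
  exact hcoframe

lemma EndField.contDiffAt_inChart_of_intertwines [CompleteSpace E] {f : M → M'}
    {x₀ : M} (hf : ContMDiffAt I I' ∞ f x₀) {J : EndField I M} {J' : EndField I' M'}
    (hJ' : ContDiffAt ℝ ∞ (J'.inChart (f x₀)) (extChartAt I' (f x₀) (f x₀)))
    (h : ∀ᶠ x in 𝓝 x₀, ∀ u : E, diffAt I I' f x (J.val x u) = J'.val (f x) (diffAt I I' f x u))
    (hinv : (diffAt I I' f x₀).IsInvertible) :
    ContDiffAt ℝ ∞ (J.inChart x₀) (extChartAt I x₀ x₀) := by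
  have hφ := contDiffAt_chartMap hf
  have hdφ := hφ.fderiv_right (m := ∞) (by simp)
  obtain ⟨e, he⟩ := hinv
  rw [← fderiv_chartMap_self hf] at he
  have hinverse : ContDiffAt ℝ ∞ (fun y => (fderiv ℝ (chartMap I I' f x₀) y).inverse)
      (extChartAt I x₀ x₀) :=
    (he ▸ contDiffAt_map_inverse (𝕜 := ℝ) (n := ∞) e).comp _ hdφ
  have hequiv : ∀ᶠ y in 𝓝 (extChartAt I x₀ x₀), ∃ e' : E ≃L[ℝ] E',
      (e' : E →L[ℝ] E') = fderiv ℝ (chartMap I I' f x₀) y :=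
    hdφ.continuousAt.eventually (he ▸ ContinuousLinearEquiv.nhds e)
  rw [← chartMap_self (I := I)] at hJ'
  have hconj : ContDiffAt ℝ ∞ (fun y => (fderiv ℝ (chartMap I I' f x₀) y).inverse.comp
      ((J'.inChart (f x₀) (chartMap I I' f x₀ y)).comp (fderiv ℝ (chartMap I I' f x₀) y)))
      (extChartAt I x₀ x₀) :=
    hinverse.clm_comp ((hJ'.comp _ hφ).clm_comp hdφ)
  refine hconj.congr_of_eventuallyEq ?_
  filter_upwards [eventually_mdifferentiableInCharts hf, (tendsto_extChartAt_symm x₀).eventually h,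
    hequiv] with y hy hJy ⟨e', he'⟩
  ext u
  rw [ContinuousLinearMap.comp_apply, ContinuousLinearMap.comp_apply,
    ← EndField.inChart_intertwines hy hJy u, ← he', ContinuousLinearMap.inverse_equiv]
  exact (e'.symm_apply_apply _).symm

lemma FormField.inChart_pullback {k : ℕ} {α : FormField I' M' k} {f : M → M'} {x₀ : M} {y : E}
    (hy : MDifferentiableInCharts I I' f x₀ y) :
    (α.pullback (I := I) f).inChart x₀ y =
      (α.inChart (f x₀) (chartMap I I' f x₀ y)).compContinuousLinearMap
        (fderiv ℝ (chartMap I I' f x₀) y) := by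
  ext v
  rw [ContinuousAlternatingMap.compContinuousLinearMap_apply, FormField.inChart_apply,
    FormField.inChart_apply, FormField.pullback_apply, hy.extChartAt_symm_chartMap]
  simp only [diffAt_comp_frameAt hy, Function.comp_apply]

lemma FormField.IsDifferentiable.pullback {k : ℕ} {α : FormField I' M' k}
    (hα : α.IsDifferentiable) {f : M → M'} (hf : ContMDiff I I' ∞ f) :
    (α.pullback (I := I) f).IsDifferentiable := by
  intro x₀
  have hφ := contDiffAt_chartMap hf.contMDiffAt (x₀ := x₀)
  have hdφ := hφ.fderiv_right (m := ∞) (by simp)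
  have hαφ := hα (f x₀)
  rw [← chartMap_self (I := I)] at hαφ
  have hpullback : DifferentiableAt ℝ (fun y =>
      (α.inChart (f x₀) (chartMap I I' f x₀ y)).compContinuousLinearMap
        (fderiv ℝ (chartMap I I' f x₀) y)) (extChartAt I x₀ x₀) :=
    DifferentiableAt.continuousAlternatingMapCompContinuousLinearMap
      (hαφ.comp _ (hφ.differentiableAt (by simp))) (hdφ.differentiableAt (by simp))
  refine hpullback.congr_of_eventuallyEq ?_
  filter_upwards [eventually_mdifferentiableInCharts hf.contMDiffAt] with y hy
  exact FormField.inChart_pullback hy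

end Naturality

/-! ### Hermitian structures and products -/

section HermitianForms

variable {E : Type*} [NormedAddCommGroup E] [NormedSpace ℝ E]
  {H : Type*} [TopologicalSpace H] {I : ModelWithCorners ℝ E H}
  {M : Type*} [TopologicalSpace M] [ChartedSpace H M] [IsManifold I ∞ M]
  {E' : Type*} [NormedAddCommGroup E'] [NormedSpace ℝ E']
  {H' : Type*} [TopologicalSpace H'] {I' : ModelWithCorners ℝ E' H'}
  {M' : Type*} [TopologicalSpace M'] [ChartedSpace H' M'] [IsManifold I' ∞ M']

namespace HermitianStructure

/-- The metric of a Hermitian structure at a point, typed on the model space. -/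
def gval (S : HermitianStructure I M) (x : M) : E →L[ℝ] E →L[ℝ] ℝ :=
  BilinField.val S.metric.inner x

lemma fundamentalForm_val (S : HermitianStructure I M) (x : M) (v : Fin 2 → E) :
    S.fundamentalForm.val x v = S.gval x (S.J.val x (v 0)) (v 1) := rfl

lemma dcOmega_val (S : HermitianStructure I M) (x : M) (v : Fin 3 → E) :
    S.dcOmega.val x v = -S.fundamentalForm.d.val x (fun i => S.J.val x (v i)) := rfl

lemma fundamentalForm_inChart (S : HermitianStructure I M) {x₀ : M} {y : E}
    (hy : y ∈ (extChartAt I x₀).target) (v : Fin 2 → E) :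
    S.fundamentalForm.inChart x₀ y v =
      BilinField.inChart S.metric.inner x₀ y (S.J.inChart x₀ y (v 0)) (v 1) := by
  rw [FormField.inChart_apply, fundamentalForm_val, BilinField.inChart, EndField.inChart,
    ContinuousLinearMap.bilinearComp_apply, ContinuousLinearMap.comp_apply,
    frameAt_comp_coframeAt hy]
  rfl

lemma fundamentalForm_eq_pullback {S : HermitianStructure I M} {T : HermitianStructure I' M'}
    {f : M → M'} (hg : PullsBackMetric f S.metric.inner T.metric.inner)
    (hJ : Intertwines f S.J T.J) :
    S.fundamentalForm = T.fundamentalForm.pullback f := by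
  refine FormField.ext_val fun x v => ?_
  rw [FormField.pullback_apply, fundamentalForm_val, fundamentalForm_val, ← hJ.val]
  exact (hg.val x _ _).symm

lemma dcOmega_eq_pullback_of_d {S : HermitianStructure I M} {T : HermitianStructure I' M'}
    {f : M → M'} (hd : S.fundamentalForm.d = T.fundamentalForm.d.pullback f)
    (hJ : Intertwines f S.J T.J) : S.dcOmega = T.dcOmega.pullback f := by
  refine FormField.ext_val fun x v => ?_
  rw [FormField.pullback_apply, dcOmega_val, dcOmega_val, hd, FormField.pullback_apply]
  simp only [hJ.val]

end HermitianStructure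

variable [I.Boundaryless]

lemma SmoothMetric.contDiffAt_inChart (g : SmoothMetric I M) (x : M) :
    ContDiffAt ℝ ∞ (BilinField.inChart g.inner x) (extChartAt I x x) :=
  BilinField.contMDiffAt_iff.1 g.contMDiff.contMDiffAt

lemma IsComplexStructure.contDiffAt_inChart {J : EndField I M} (hJ : IsComplexStructure J)
    (x : M) : ContDiffAt ℝ ∞ (J.inChart x) (extChartAt I x x) :=
  EndField.contMDiffAt_iff.1 hJ.smooth.contMDiffAt

namespace HermitianStructure

variable [FiniteDimensional ℝ E]

lemma fundamentalForm_contDiffAt (S : HermitianStructure I M) (x : M) :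
    ContDiffAt ℝ ∞ (S.fundamentalForm.inChart x) (extChartAt I x x) := by
  refine contDiffAt_alternating_of_apply fun v => ?_
  have hgJ : ContDiffAt ℝ ∞ (fun y => BilinField.inChart S.metric.inner x y
      (S.J.inChart x y (v 0)) (v 1)) (extChartAt I x x) :=
    ((S.metric.contDiffAt_inChart x).clm_apply
      ((S.isComplex.contDiffAt_inChart x).clm_apply contDiffAt_const)).clm_apply contDiffAt_const
  refine hgJ.congr_of_eventuallyEq ?_
  filter_upwards [extChartAt_target_mem_nhds (I := I) x] with y hy
  exact S.fundamentalForm_inChart hy v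

lemma fundamentalForm_isDifferentiable (S : HermitianStructure I M) :
    S.fundamentalForm.IsDifferentiable :=
  fun x => (S.fundamentalForm_contDiffAt x).differentiableAt (by simp)

lemma dcOmega_inChart (S : HermitianStructure I M) {x₀ : M} {y : E}
    (hy : y ∈ (extChartAt I x₀).target) :
    S.dcOmega.inChart x₀ y =
      -(extDeriv (S.fundamentalForm.inChart x₀) y).compContinuousLinearMap
        (S.J.inChart x₀ y) := by
  ext v
  rw [FormField.inChart_apply, dcOmega_val,
    ← FormField.inChart_d S.fundamentalForm_isDifferentiable hy, ContinuousAlternatingMap.neg_apply,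
    ContinuousAlternatingMap.compContinuousLinearMap_apply, FormField.inChart_apply]
  refine congrArg (fun w => -S.fundamentalForm.d.val _ w) (funext fun i => ?_)
  exact (frameAt_comp_coframeAt hy _).symm

lemma dcOmega_isDifferentiable (S : HermitianStructure I M) : S.dcOmega.IsDifferentiable := by
  intro x
  have hd : DifferentiableAt ℝ (extDeriv (S.fundamentalForm.inChart x)) (extChartAt I x x) :=
    (ContinuousAlternatingMap.alternatizeUncurryFinCLM ℝ E ℝ).differentiableAt.comp _
      (((S.fundamentalForm_contDiffAt x).fderiv_right (m := ∞) (by simp)).differentiableAt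
        (by simp))
  have hneg : DifferentiableAt ℝ (fun y => -(extDeriv (S.fundamentalForm.inChart x)
      y).compContinuousLinearMap (S.J.inChart x y)) (extChartAt I x x) :=
    (DifferentiableAt.continuousAlternatingMapCompContinuousLinearMap hd
      ((S.isComplex.contDiffAt_inChart x).differentiableAt (by simp))).neg
  refine hneg.congr_of_eventuallyEq ?_
  filter_upwards [extChartAt_target_mem_nhds (I := I) x] with y hy
  exact S.dcOmega_inChart hy

end HermitianStructure

variable [I'.Boundaryless] [FiniteDimensional ℝ E'] in
lemma HermitianStructure.dcOmega_eq_pullback {S : HermitianStructure I M}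
    {T : HermitianStructure I' M'} {f : M → M'} (hf : ContMDiff I I' ∞ f)
    (hg : PullsBackMetric f S.metric.inner T.metric.inner)
    (hJ : Intertwines f S.J T.J) : S.dcOmega = T.dcOmega.pullback f := by
  refine dcOmega_eq_pullback_of_d ?_ hJ
  rw [fundamentalForm_eq_pullback hg hJ,
    FormField.d_pullback T.fundamentalForm_isDifferentiable hf]

end HermitianForms

section Products

variable {E : Type*} [NormedAddCommGroup E] [NormedSpace ℝ E]
  {H : Type*} [TopologicalSpace H] {I : ModelWithCorners ℝ E H}
  {M : Type*} [TopologicalSpace M] [ChartedSpace H M]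
  {E' : Type*} [NormedAddCommGroup E'] [NormedSpace ℝ E']
  {H' : Type*} [TopologicalSpace H'] {I' : ModelWithCorners ℝ E' H'}
  {M' : Type*} [TopologicalSpace M'] [ChartedSpace H' M']

lemma mdifferentiableAt_pi_apply {ι : Type*} [Fintype ι] {f : M → ι → ℂ} {x : M}
    (hf : MDifferentiableAt I 𝓘(ℝ, ι → ℂ) f x) (j : ι) :
    MDifferentiableAt I 𝓘(ℝ, ℂ) (fun z => f z j) x :=
  (ContinuousLinearMap.proj (R := ℝ) (φ := fun _ : ι => ℂ) j).mdifferentiableAt.comp x hf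

lemma diffAt_pi_apply {ι : Type*} [Fintype ι] {f : M → ι → ℂ} {x : M}
    (hf : MDifferentiableAt I 𝓘(ℝ, ι → ℂ) f x) (u : E) (j : ι) :
    diffAt I 𝓘(ℝ, ι → ℂ) f x u j = diffAt I 𝓘(ℝ, ℂ) (fun z => f z j) x u := by
  let proj := ContinuousLinearMap.proj (R := ℝ) (φ := fun _ : ι => ℂ) j
  have diffAt_proj : diffAt 𝓘(ℝ, ι → ℂ) 𝓘(ℝ, ℂ) proj (f x) = proj := proj.mfderiv_eq
  have hcomp := diffAt_comp (g := proj) proj.mdifferentiableAt hf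
  rw [diffAt_proj] at hcomp
  exact (congrArg (fun L : E →L[ℝ] ℂ => L u) hcomp).symm

/-- The product of two local charts with values in `ℂ^r` and `ℂ^s`, as a chart with values in
`ℂ^(r + s)`. -/
def prodAppendDiffeomorph {r s : ℕ}
    (φ : PartialDiffeomorph I 𝓘(ℝ, Fin r → ℂ) M (Fin r → ℂ) ∞)
    (φ' : PartialDiffeomorph I' 𝓘(ℝ, Fin s → ℂ) M' (Fin s → ℂ) ∞) :
    PartialDiffeomorph (I.prod I') 𝓘(ℝ, Fin (r + s) → ℂ) (M × M') (Fin (r + s) → ℂ) ∞ where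
  toFun x := Fin.append (φ x.1) (φ' x.2)
  invFun z := (φ.symm fun i => z (Fin.castAdd s i), φ'.symm fun i => z (Fin.natAdd r i))
  source := φ.source ×ˢ φ'.source
  target := (fun z i => z (Fin.castAdd s i)) ⁻¹' φ.target ∩
    (fun z i => z (Fin.natAdd r i)) ⁻¹' φ'.target
  map_source' x hx := by
    refine ⟨?_, ?_⟩
    · simpa using φ.map_source hx.1
    · simpa using φ'.map_source hx.2
  map_target' z hz := ⟨φ.map_target hz.1, φ'.map_target hz.2⟩
  left_inv' x hx := by
    refine Prod.ext ?_ ?_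
    · simpa using φ.left_inv hx.1
    · simpa using φ'.left_inv hx.2
  right_inv' z hz := by
    ext i
    refine Fin.addCases (fun j => ?_) (fun j => ?_) i
    · rw [Fin.append_left]
      exact congrFun (φ.right_inv hz.1) j
    · rw [Fin.append_right]
      exact congrFun (φ'.right_inv hz.2) j
  open_source := φ.open_source.prod φ'.open_source
  open_target := (φ.open_target.preimage (by fun_prop)).inter
    (φ'.open_target.preimage (by fun_prop))
  contMDiffOn_toFun := by
    rw [contMDiffOn_pi_space]
    intro i
    refine Fin.addCases (fun j => ?_) (fun j => ?_) i
    · simp only [Fin.append_left]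
      exact (contMDiffOn_pi_space.1 φ.contMDiffOn j).comp contMDiffOn_fst fun x hx => hx.1
    · simp only [Fin.append_right]
      exact (contMDiffOn_pi_space.1 φ'.contMDiffOn j).comp contMDiffOn_snd fun x hx => hx.2
  contMDiffOn_invFun := by
    refine ContMDiffOn.prodMk ?_ ?_
    · refine φ.symm.contMDiffOn.comp (ContMDiff.contMDiffOn ?_) fun x hx => hx.1
      exact contMDiff_iff_contDiff.2 (by fun_prop)
    · refine φ'.symm.contMDiffOn.comp (ContMDiff.contMDiffOn ?_) fun x hx => hx.2
      exact contMDiff_iff_contDiff.2 (by fun_prop)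

lemma diffAt_prodAppendDiffeomorph {r s : ℕ}
    {φ : PartialDiffeomorph I 𝓘(ℝ, Fin r → ℂ) M (Fin r → ℂ) ∞}
    {φ' : PartialDiffeomorph I' 𝓘(ℝ, Fin s → ℂ) M' (Fin s → ℂ) ∞} {y : M × M'}
    (hy : y.1 ∈ φ.source) (hy' : y.2 ∈ φ'.source) (w : E × E') :
    diffAt (I.prod I') 𝓘(ℝ, Fin (r + s) → ℂ) (prodAppendDiffeomorph φ φ') y w =
      Fin.append (diffAt I 𝓘(ℝ, Fin r → ℂ) φ y.1 w.1) (diffAt I' 𝓘(ℝ, Fin s → ℂ) φ' y.2 w.2) := by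
  have hφ := φ.mdifferentiableAt (by simp) hy
  have hφ' := φ'.mdifferentiableAt (by simp) hy'
  ext i
  rw [diffAt_pi_apply
    ((prodAppendDiffeomorph φ φ').mdifferentiableAt (by simp) (x := y) ⟨hy, hy'⟩)]
  refine Fin.addCases (fun j => ?_) (fun j => ?_) i
  · have append_castAdd : (fun z => prodAppendDiffeomorph φ φ' z (Fin.castAdd s j)) =
        fun z : M × M' => φ z.1 j := funext fun z => Fin.append_left _ _ j
    rw [Fin.append_left, diffAt_pi_apply hφ, append_castAdd,
      diffAt_comp (g := fun z => φ z j) (f := Prod.fst) (mdifferentiableAt_pi_apply hφ j)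
        mdifferentiableAt_fst, diffAt_fst]
    rfl
  · have append_natAdd : (fun z => prodAppendDiffeomorph φ φ' z (Fin.natAdd r j)) =
        fun z : M × M' => φ' z.2 j := funext fun z => Fin.append_right _ _ j
    rw [Fin.append_right, diffAt_pi_apply hφ', append_natAdd,
      diffAt_comp (g := fun z => φ' z j) (f := Prod.snd) (mdifferentiableAt_pi_apply hφ' j)
        mdifferentiableAt_snd, diffAt_snd]
    rfl

variable [IsManifold I ∞ M] [IsManifold I' ∞ M']

omit [IsManifold I' ∞ M'] in
lemma SmoothMetric.val_self_nonneg (g : SmoothMetric I M) (x : M) (u : E) :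
    0 ≤ BilinField.val g.inner x u u := by
  by_cases hu : u = 0
  · simp [hu]
  · exact (g.pos x u hu).le

lemma prodBilin_pos (g : SmoothMetric I M) (g' : SmoothMetric I' M') (x : M × M') {v : E × E'}
    (hv : v ≠ 0) : 0 < (prodBilin g.inner g'.inner).val x v v := by
  rw [prodBilin_val]
  by_cases hv₁ : v.1 = 0
  · exact add_pos_of_nonneg_of_pos (g.val_self_nonneg x.1 v.1)
      (g'.pos x.2 v.2 fun hv₂ => hv (Prod.ext hv₁ hv₂))
  · exact add_pos_of_pos_of_nonneg (g.pos x.1 v.1 hv₁) (g'.val_self_nonneg x.2 v.2)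

lemma isVonNBounded_prodBilin_unitBall (g : SmoothMetric I M) (g' : SmoothMetric I' M')
    (x : M × M') :
    Bornology.IsVonNBounded ℝ {v : E × E' | (prodBilin g.inner g'.inner).val x v v < 1} := by
  have hball : Bornology.IsBounded {u : E | BilinField.val g.inner x.1 u u < 1} :=
    (NormedSpace.isVonNBounded_iff ℝ).1 (g.isVonNBounded x.1)
  have hball' : Bornology.IsBounded {u : E' | BilinField.val g'.inner x.2 u u < 1} :=
    (NormedSpace.isVonNBounded_iff ℝ).1 (g'.isVonNBounded x.2)
  refine (NormedSpace.isVonNBounded_iff ℝ).2 ((hball.prod hball').subset fun v hv => ?_)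
  have hsum : BilinField.val g.inner x.1 v.1 v.1 + BilinField.val g'.inner x.2 v.2 v.2 < 1 := hv
  have hleft := g.val_self_nonneg x.1 v.1
  have hright := g'.val_self_nonneg x.2 v.2
  exact ⟨hsum.trans_le' (le_add_of_nonneg_right hright),
    hsum.trans_le' (le_add_of_nonneg_left hleft)⟩

variable [I.Boundaryless] [I'.Boundaryless]

omit [IsManifold I ∞ M] [IsManifold I' ∞ M'] in
lemma chartMap_fst_eventuallyEq {x : M × M'} {y : E × E'}
    (hy : y ∈ (extChartAt (I.prod I') x).target) :
    chartMap (I.prod I') I Prod.fst x =ᶠ[𝓝 y] Prod.fst := by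
  filter_upwards [(isOpen_extChartAt_target x).mem_nhds hy] with z hz
  rw [extChartAt_prod] at hz
  rw [chartMap, extChartAt_prod]
  exact (extChartAt I x.1).right_inv hz.1

omit [IsManifold I ∞ M] [IsManifold I' ∞ M'] in
lemma chartMap_snd_eventuallyEq {x : M × M'} {y : E × E'}
    (hy : y ∈ (extChartAt (I.prod I') x).target) :
    chartMap (I.prod I') I' Prod.snd x =ᶠ[𝓝 y] Prod.snd := by
  filter_upwards [(isOpen_extChartAt_target x).mem_nhds hy] with z hz
  rw [extChartAt_prod] at hz
  rw [chartMap, extChartAt_prod]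
  exact (extChartAt I' x.2).right_inv hz.2

lemma prodEnd_inChart {J : EndField I M} {J' : EndField I' M'} {x : M × M'} {y : E × E'}
    (hy : y ∈ (extChartAt (I.prod I') x).target) (u : E × E') :
    (prodEnd J J').inChart x y u = (J.inChart x.1 y.1 u.1, J'.inChart x.2 y.2 u.2) := by
  have hy' := hy
  rw [extChartAt_prod] at hy'
  have hfst := EndField.inChart_intertwines (f := (Prod.fst : M × M' → M)) (J := prodEnd J J')
    (J' := J) ⟨hy, mdifferentiableAt_fst,
      by rw [extChartAt_prod]; exact (extChartAt I x.1).map_target hy'.1⟩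
    (fun u => by rw [diffAt_fst]; rfl) u
  have hsnd := EndField.inChart_intertwines (f := (Prod.snd : M × M' → M')) (J := prodEnd J J')
    (J' := J') ⟨hy, mdifferentiableAt_snd,
      by rw [extChartAt_prod]; exact (extChartAt I' x.2).map_target hy'.2⟩
    (fun u => by rw [diffAt_snd]; rfl) u
  rw [(chartMap_fst_eventuallyEq hy).fderiv_eq, fderiv_fst,
    (chartMap_fst_eventuallyEq hy).eq_of_nhds] at hfst
  rw [(chartMap_snd_eventuallyEq hy).fderiv_eq, fderiv_snd,
    (chartMap_snd_eventuallyEq hy).eq_of_nhds] at hsnd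
  exact Prod.ext hfst hsnd

variable [FiniteDimensional ℝ E] [FiniteDimensional ℝ E']

lemma prodBilin_contDiffAt_inChart {g : BilinField I M} {g' : BilinField I' M'} {x : M × M'}
    (hg : ContDiffAt ℝ ∞ (g.inChart x.1) (extChartAt I x.1 x.1))
    (hg' : ContDiffAt ℝ ∞ (g'.inChart x.2) (extChartAt I' x.2 x.2)) :
    ContDiffAt ℝ ∞ ((prodBilin g g').inChart x) (extChartAt (I.prod I') x x) := by
  let fstPart : BilinField (I.prod I') (M × M') := fun z =>
    (g.val z.1).bilinearComp (ContinuousLinearMap.fst ℝ E E') (ContinuousLinearMap.fst ℝ E E')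
  let sndPart : BilinField (I.prod I') (M × M') := fun z =>
    (g'.val z.2).bilinearComp (ContinuousLinearMap.snd ℝ E E') (ContinuousLinearMap.snd ℝ E E')
  have hfst : ContDiffAt ℝ ∞ (fstPart.inChart x) (extChartAt (I.prod I') x x) := by
    refine BilinField.contDiffAt_inChart_of_pullback (f := Prod.fst) contMDiffAt_fst hg
      (Filter.Eventually.of_forall fun z u v => ?_)
    rw [diffAt_fst]
    rfl
  have hsnd : ContDiffAt ℝ ∞ (sndPart.inChart x) (extChartAt (I.prod I') x x) := by
    refine BilinField.contDiffAt_inChart_of_pullback (f := Prod.snd) contMDiffAt_snd hg'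
      (Filter.Eventually.of_forall fun z u v => ?_)
    rw [diffAt_snd]
    rfl
  exact hfst.add hsnd

lemma prodEnd_contDiffAt_inChart {J : EndField I M} {J' : EndField I' M'} {x : M × M'}
    (hJ : ContDiffAt ℝ ∞ (J.inChart x.1) (extChartAt I x.1 x.1))
    (hJ' : ContDiffAt ℝ ∞ (J'.inChart x.2) (extChartAt I' x.2 x.2)) :
    ContDiffAt ℝ ∞ ((prodEnd J J').inChart x) (extChartAt (I.prod I') x x) := by
  refine contDiffAt_clm_of_apply fun u => ?_
  have hprod : ContDiffAt ℝ ∞ (fun y : E × E' =>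
      (J.inChart x.1 y.1 u.1, J'.inChart x.2 y.2 u.2)) (extChartAt (I.prod I') x x) := by
    rw [extChartAt_prod]
    refine ContDiffAt.prodMk ?_ ?_
    · exact (ContDiffAt.comp (extChartAt I x.1 x.1, extChartAt I' x.2 x.2) hJ
        contDiffAt_fst).clm_apply contDiffAt_const
    · exact (ContDiffAt.comp (extChartAt I x.1 x.1, extChartAt I' x.2 x.2) hJ'
        contDiffAt_snd).clm_apply contDiffAt_const
  refine hprod.congr_of_eventuallyEq ?_
  filter_upwards [extChartAt_target_mem_nhds (I := I.prod I') x] with y hy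
  exact prodEnd_inChart hy u

/-- The product of two smooth metrics. -/
def SmoothMetric.prod (g : SmoothMetric I M) (g' : SmoothMetric I' M') :
    SmoothMetric (I.prod I') (M × M') where
  inner := prodBilin g.inner g'.inner
  symm x u v := congrArg₂ (· + ·) (g.symm x.1 (u : E × E').1 (v : E × E').1)
    (g'.symm x.2 (u : E × E').2 (v : E × E').2)
  pos x _ hv := prodBilin_pos g g' x hv
  isVonNBounded x := isVonNBounded_prodBilin_unitBall g g' x
  contMDiff x := BilinField.contMDiffAt_iff.2
    (prodBilin_contDiffAt_inChart (g.contDiffAt_inChart x.1) (g'.contDiffAt_inChart x.2))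

lemma IsComplexStructure.prodEnd {J : EndField I M} {J' : EndField I' M'}
    (hJ : IsComplexStructure J) (hJ' : IsComplexStructure J') :
    IsComplexStructure (prodEnd J J') where
  smooth x := EndField.contMDiffAt_iff.2
    (prodEnd_contDiffAt_inChart (hJ.contDiffAt_inChart x.1) (hJ'.contDiffAt_inChart x.2))
  sq x u := Prod.ext (hJ.sq x.1 (u : E × E').1) (hJ'.sq x.2 (u : E × E').2)
  integrable x := by
    obtain ⟨r, φ, hx, hφ⟩ := hJ.integrable x.1
    obtain ⟨s, φ', hx', hφ'⟩ := hJ'.integrable x.2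
    refine ⟨r + s, prodAppendDiffeomorph φ φ', ⟨hx, hx'⟩, ?_⟩
    rintro y ⟨hy, hy'⟩ u j
    refine (congrFun (diffAt_prodAppendDiffeomorph hy hy' _) j).trans (Eq.trans ?_
      (congrArg (Complex.I * ·) (congrFun (diffAt_prodAppendDiffeomorph hy hy' u) j)).symm)
    refine Fin.addCases (fun j => ?_) (fun j => ?_) j
    · simp only [Fin.append_left]
      exact hφ y.1 hy (u : E × E').1 j
    · simp only [Fin.append_right]
      exact hφ' y.2 hy' (u : E × E').2 j

/-- The product of two Hermitian structures. -/
def HermitianStructure.prod (S : HermitianStructure I M) (T : HermitianStructure I' M') :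
    HermitianStructure (I.prod I') (M × M') where
  metric := S.metric.prod T.metric
  J := prodEnd S.J T.J
  isComplex := S.isComplex.prodEnd T.isComplex
  compatible x u v := congrArg₂ (· + ·) (S.compatible x.1 (u : E × E').1 (v : E × E').1)
    (T.compatible x.2 (u : E × E').2 (v : E × E').2)

lemma HermitianStructure.prod_fundamentalForm (S : HermitianStructure I M)
    (T : HermitianStructure I' M') :
    (S.prod T).fundamentalForm =
      S.fundamentalForm.pullback Prod.fst + T.fundamentalForm.pullback Prod.snd := by
  refine FormField.ext_val fun x v => ?_
  change _ = (S.fundamentalForm.pullback (I := I.prod I') (M := M × M') Prod.fst).val x v +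
    (T.fundamentalForm.pullback (I := I.prod I') (M := M × M') Prod.snd).val x v
  rw [FormField.pullback_apply, FormField.pullback_apply, diffAt_fst, diffAt_snd]
  rfl

lemma HermitianStructure.prod_dcOmega_of_isKahler {S : HermitianStructure I M}
    (T : HermitianStructure I' M') (hS : S.IsKahler) :
    (S.prod T).dcOmega = T.dcOmega.pullback Prod.snd := by
  refine dcOmega_eq_pullback_of_d ?_ fun x u => ?_
  · have pullback_zero :
        (0 : FormField I M 3).pullback (I := I.prod I') (Prod.fst : M × M' → M) = 0 := rfl
    rw [prod_fundamentalForm, FormField.d_add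
      (S.fundamentalForm_isDifferentiable.pullback contMDiff_fst)
      (T.fundamentalForm_isDifferentiable.pullback contMDiff_snd),
      FormField.d_pullback S.fundamentalForm_isDifferentiable contMDiff_fst,
      FormField.d_pullback T.fundamentalForm_isDifferentiable contMDiff_snd, hS, pullback_zero,
      zero_add]
  · have diffAt_snd_apply (w : E × E') : diffAt (I.prod I') I' (Prod.snd : M × M' → M') x w =
        w.2 := by rw [diffAt_snd]; rfl
    exact (diffAt_snd_apply _).trans (congrArg (T.J.val x.2) (diffAt_snd_apply u)).symm

end Products

/-! ### Quotients by deck transformations -/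

section QuotientManifold

variable {E : Type*} [NormedAddCommGroup E] [NormedSpace ℝ E]
  {H : Type*} [TopologicalSpace H] {I : ModelWithCorners ℝ E H}
  {X : Type*} [TopologicalSpace X] [ChartedSpace H X] {M : Type*} {pr : X → M}

variable (I) in
/-- The smooth deck transformations of `pr : X → M` which satisfy `P` act transitively on each
fibre of `pr`. The predicate `P` records which structures on `X` these transformations preserve. -/
def IsDeckTransitive (pr : X → M) (P : (X → X) → Prop) : Prop :=
  ∀ x y, pr x = pr y → ∃ τ : X → X, ContMDiff I I ∞ τ ∧ (∀ z, pr (τ z) = pr z) ∧ P τ ∧ τ x = y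

lemma IsDeckTransitive.mono {P Q : (X → X) → Prop} (h : IsDeckTransitive I pr P)
    (hPQ : ∀ τ, P τ → Q τ) : IsDeckTransitive I pr Q := fun x y hxy => by
  obtain ⟨τ, hτ, hpr, hP, hx⟩ := h x y hxy
  exact ⟨τ, hτ, hpr, hPQ τ hP, hx⟩

variable [TopologicalSpace M] (hπ : IsLocalHomeomorph pr)
  (hdeck : IsDeckTransitive I pr fun _ => True)

omit [ChartedSpace H X] in
lemma localInverseAt_comp_eventuallyEq {a x : X} {τ : X → X} (hτ : Continuous τ)
    (hpr : ∀ z, pr (τ z) = pr z) (hx : τ x ∈ (hπ.localInverseAt a).target) :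
    (fun z => hπ.localInverseAt a (pr z)) =ᶠ[𝓝 x] τ := by
  filter_upwards [hτ.continuousAt.preimage_mem_nhds
    ((hπ.localInverseAt a).open_target.mem_nhds hx)] with z hz
  rw [← hpr z, ← congrFun (hπ.localInverseAt_symm a) (τ z)]
  exact (hπ.localInverseAt a).right_inv hz

include hdeck in
/-- Near `x` this map is the deck transformation that moves `x` into the chosen sheet. -/
lemma contMDiffAt_localInverseAt_comp {a x : X} (hx : pr x ∈ (hπ.localInverseAt a).source) :
    ContMDiffAt I I ∞ (fun z => hπ.localInverseAt a (pr z)) x := by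
  obtain ⟨τ, hτ, hpr, -, hτx⟩ := hdeck x (hπ.localInverseAt a (pr x))
    (hπ.apply_localInverseAt_of_mem hx).symm
  refine hτ.contMDiffAt.congr_of_eventuallyEq
    (localInverseAt_comp_eventuallyEq hπ hτ.continuous hpr ?_)
  rw [hτx]
  exact (hπ.localInverseAt a).map_source hx

variable [IsManifold I ∞ X] {sec : M → X} (hsec : Function.RightInverse sec pr)

include hdeck in
lemma isManifold_chartedSpaceOfRightInverse [I.Boundaryless] :
    letI : ChartedSpace H M := hπ.chartedSpaceOfRightInverse hsec
    IsManifold I ∞ M := by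
  let : ChartedSpace H M := hπ.chartedSpaceOfRightInverse hsec
  refine isManifold_of_contDiffOn I ∞ M ?_
  rintro _ _ ⟨q, rfl⟩ ⟨q', rfl⟩ z ⟨hz, -⟩
  apply ContDiffAt.contDiffWithinAt
  simp only [OpenPartialHomeomorph.trans_symm_eq_symm_trans_symm,
    OpenPartialHomeomorph.trans_source, OpenPartialHomeomorph.symm_source,
    OpenPartialHomeomorph.coe_trans, Set.mem_preimage, Set.mem_inter_iff, Function.comp_apply,
    IsLocalHomeomorph.localInverseAt_symm] at hz
  obtain ⟨⟨hz_target, -⟩, hz_sheet, hz_source⟩ := hz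
  have hsymm := contMDiffAt_extChartAt_symm (I := I) (x₀ := sec q) (y := z) (by
    rw [extChartAt_target]
    exact ⟨hz_target, by simp [I.range_eq_univ]⟩)
  have htransition := (contMDiffAt_extChartAt' (I := I) (n := ∞) hz_source).comp z
    ((contMDiffAt_localInverseAt_comp hπ hdeck hz_sheet).comp z hsymm)
  refine (contMDiffAt_iff_contDiffAt.1 htransition).congr_of_eventuallyEq
    (Filter.Eventually.of_forall fun y => ?_)
  simp only [OpenPartialHomeomorph.trans_symm_eq_symm_trans_symm,
    OpenPartialHomeomorph.coe_trans, Function.comp_apply, IsLocalHomeomorph.localInverseAt_symm]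
  rfl

include hdeck in
lemma contMDiff_of_chartedSpaceOfRightInverse :
    letI : ChartedSpace H M := hπ.chartedSpaceOfRightInverse hsec
    ContMDiff I I ∞ pr := by
  let : ChartedSpace H M := hπ.chartedSpaceOfRightInverse hsec
  intro x
  have hsource : pr x ∈ (hπ.localInverseAt (sec (pr x))).source := by
    simpa only [hsec (pr x)] using hπ.apply_self_mem_localInverseAt_source (x := sec (pr x))
  refine contMDiffAt_iff_target.2 ⟨hπ.continuous.continuousAt, ?_⟩
  refine ContMDiffAt.comp (I' := I) (g := extChartAt I (sec (pr x)))
    (f := fun z => hπ.localInverseAt (sec (pr x)) (pr z)) x (contMDiffAt_extChartAt' ?_)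
    (contMDiffAt_localInverseAt_comp hπ hdeck hsource)
  exact (mem_chart_source H (pr x)).2

include hdeck in
/-- By construction the charts of `M` read this branch as an identity map. -/
lemma contMDiffAt_localInverseAt_rightInverse [I.Boundaryless] (y : M) :
    letI : ChartedSpace H M := hπ.chartedSpaceOfRightInverse hsec
    ContMDiffAt I I ∞ (hπ.localInverseAt (sec y)) y := by
  let : ChartedSpace H M := hπ.chartedSpaceOfRightInverse hsec
  have := isManifold_chartedSpaceOfRightInverse hπ hdeck hsec
  have hsource : y ∈ (hπ.localInverseAt (sec y)).source := by
    simpa only [hsec y] using hπ.apply_self_mem_localInverseAt_source (x := sec y)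
  have hbranch : hπ.localInverseAt (sec y) y = sec y := by
    simpa only [hsec y] using hπ.localInverseAt_apply_self (x := sec y)
  have hchart : extChartAt I y y = extChartAt I (sec y) (sec y) :=
    congrArg (extChartAt I (sec y)) hbranch
  have hsmooth : ContMDiffAt I I ∞
      (fun w => (extChartAt I (sec y)).symm (extChartAt I y w)) y := by
    refine ContMDiffAt.comp (I' := 𝓘(ℝ, E)) (g := (extChartAt I (sec y)).symm) y
      (contMDiffAt_extChartAt_symm ?_) contMDiffAt_extChartAt
    rw [hchart]
    exact mem_extChartAt_target _
  refine hsmooth.congr_of_eventuallyEq ?_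
  have hcont := (hπ.localInverseAt (sec y)).continuousAt hsource
  filter_upwards [hcont.preimage_mem_nhds ((isOpen_extChartAt_source (I := I) (sec y)).mem_nhds
    (by rw [hbranch]; exact mem_extChartAt_source _))] with w hw
  exact ((extChartAt I (sec y)).left_inv hw).symm

include hdeck in
lemma contMDiffAt_localInverseAt [I.Boundaryless] {x : X} {y : M}
    (hy : y ∈ (hπ.localInverseAt x).source) :
    letI : ChartedSpace H M := hπ.chartedSpaceOfRightInverse hsec
    ContMDiffAt I I ∞ (hπ.localInverseAt x) y := by
  let : ChartedSpace H M := hπ.chartedSpaceOfRightInverse hsec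
  have hsource : y ∈ (hπ.localInverseAt (sec y)).source := by
    simpa only [hsec y] using hπ.apply_self_mem_localInverseAt_source (x := sec y)
  have hlift : pr (hπ.localInverseAt (sec y) y) = y := hπ.apply_localInverseAt_of_mem hsource
  have hcomp := (contMDiffAt_localInverseAt_comp hπ hdeck (a := x)
    (x := hπ.localInverseAt (sec y) y) (by rwa [hlift])).comp y
    (contMDiffAt_localInverseAt_rightInverse hπ hdeck hsec y)
  refine hcomp.congr_of_eventuallyEq ?_
  filter_upwards [(hπ.localInverseAt (sec y)).open_source.mem_nhds hsource] with w hw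
  exact congrArg (hπ.localInverseAt x) (hπ.apply_localInverseAt_of_mem hw).symm

include hπ hdeck in
theorem exists_isManifold_quotient [I.Boundaryless] (hs : Function.Surjective pr) :
    ∃ (_ : ChartedSpace H M) (_ : IsManifold I ∞ M), IsLocalDiffeomorph I I ∞ pr := by
  obtain ⟨sec, hsec⟩ := hs.hasRightInverse
  let : ChartedSpace H M := hπ.chartedSpaceOfRightInverse hsec
  refine ⟨inferInstance, isManifold_chartedSpaceOfRightInverse hπ hdeck hsec, fun x => ⟨{
    toPartialEquiv := (hπ.localInverseAt x).symm.toPartialEquiv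
    open_source := (hπ.localInverseAt x).open_target
    open_target := (hπ.localInverseAt x).open_source
    contMDiffOn_toFun := ?_
    contMDiffOn_invFun := fun _ hy =>
      (contMDiffAt_localInverseAt hπ hdeck hsec hy).contMDiffWithinAt }, ?_, ?_⟩⟩
  · change ContMDiffOn I I ∞ ((hπ.localInverseAt x).symm : X → M) _
    rw [hπ.localInverseAt_symm x]
    exact (contMDiff_of_chartedSpaceOfRightInverse hπ hdeck hsec).contMDiffOn
  · exact hπ.self_mem_localInverseAt_target
  · exact fun z _ => (congrFun (hπ.localInverseAt_symm x) z).symm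

end QuotientManifold

section Descent

variable {E : Type*} [NormedAddCommGroup E] [NormedSpace ℝ E]
  {H : Type*} [TopologicalSpace H] {I : ModelWithCorners ℝ E H}
  {X : Type*} [TopologicalSpace X] [ChartedSpace H X]
  {M : Type*} [TopologicalSpace M] [ChartedSpace H M] {pr : X → M}

lemma diffAt_deck {τ : X → X} (hπ : ContMDiff I I ∞ pr) (hτ : ContMDiff I I ∞ τ)
    (hpr : ∀ z, pr (τ z) = pr z) (x : X) (v : E) :
    diffAt I I pr (τ x) (diffAt I I τ x v) = diffAt I I pr x v := by
  have hcomp := diffAt_comp (hπ.mdifferentiable (by simp) (τ x)) (hτ.mdifferentiable (by simp) x)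
  rw [funext hpr] at hcomp
  exact (congrArg (fun L : E →L[ℝ] E => L v) hcomp).symm

variable (hπ : IsLocalDiffeomorph I I ∞ pr)

/-- The inverse of the differential of a local diffeomorphism at `x`. -/
def diffInvAt (x : X) : E →L[ℝ] E :=
  ((hπ x).mfderivToContinuousLinearEquiv (by simp)).symm.toContinuousLinearMap

lemma diffInvAt_diffAt (x : X) (v : E) : diffInvAt hπ x (diffAt I I pr x v) = v :=
  ((hπ x).mfderivToContinuousLinearEquiv (by simp)).symm_apply_apply v

lemma diffAt_diffInvAt (x : X) (v : E) : diffAt I I pr x (diffInvAt hπ x v) = v :=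
  ((hπ x).mfderivToContinuousLinearEquiv (by simp)).apply_symm_apply v

lemma diffAt_diffAt_localInverse {x : X} {z : M} (hz : z ∈ (hπ x).localInverse.source) (v : E) :
    diffAt I I pr ((hπ x).localInverse z) (diffAt I I (hπ x).localInverse z v) = v := by
  have eventually_id : (fun w => pr ((hπ x).localInverse w)) =ᶠ[𝓝 z] fun w => w := by
    filter_upwards [(hπ x).localInverse.open_source.mem_nhds hz] with w hw
    exact (hπ x).localInverse_right_inv hw
  have hcomp := diffAt_congr (I := I) (I' := I) eventually_id
  rw [diffAt_id, diffAt_comp (hπ.mdifferentiable (by simp) _)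
    ((hπ x).localInverse.mdifferentiableAt (by simp) hz)] at hcomp
  exact congrArg (fun L : E →L[ℝ] E => L v) hcomp

lemma diffAt_localInverse_diffAt {x : X} {z : M} (hz : z ∈ (hπ x).localInverse.source) (v : E) :
    diffAt I I (hπ x).localInverse z (diffAt I I pr ((hπ x).localInverse z) v) = v := by
  have hright := congrArg (diffInvAt hπ ((hπ x).localInverse z))
    (diffAt_diffAt_localInverse hπ hz (diffAt I I pr ((hπ x).localInverse z) v))
  rwa [diffInvAt_diffAt, diffInvAt_diffAt] at hright

lemma PullsBackMetric.localInverse {g : BilinField I X} {h : BilinField I M}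
    (hgh : PullsBackMetric pr g h) {x : X} {z : M} (hz : z ∈ (hπ x).localInverse.source)
    (u v : E) :
    h.val z u v = g.val ((hπ x).localInverse z) (diffAt I I (hπ x).localInverse z u)
      (diffAt I I (hπ x).localInverse z v) := by
  rw [← hgh.val, diffAt_diffAt_localInverse hπ hz, diffAt_diffAt_localInverse hπ hz,
    (hπ x).localInverse_right_inv hz]

lemma Intertwines.localInverse {J : EndField I X} {J' : EndField I M}
    (hJ : Intertwines pr J J') {x : X} {z : M} (hz : z ∈ (hπ x).localInverse.source) (u : E) :
    diffAt I I (hπ x).localInverse z (J'.val z u) =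
      J.val ((hπ x).localInverse z) (diffAt I I (hπ x).localInverse z u) := by
  have hpush := hJ.val ((hπ x).localInverse z) (diffAt I I (hπ x).localInverse z u)
  rw [diffAt_diffAt_localInverse hπ hz, (hπ x).localInverse_right_inv hz] at hpush
  rw [← hpush, diffAt_localInverse_diffAt hπ hz]

include hπ in
lemma exists_pullsBackMetric_of_isDeckTransitive (hs : Function.Surjective pr) {g : BilinField I X}
    (hdeck : IsDeckTransitive I pr fun τ => PullsBackMetric τ g g) :
    ∃ h : BilinField I M, PullsBackMetric pr g h := by
  obtain ⟨sec, hsec⟩ := hs.hasRightInverse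
  let h (z : M) : E →L[ℝ] E →L[ℝ] ℝ :=
    (g.val (sec z)).bilinearComp (diffInvAt hπ (sec z)) (diffInvAt hπ (sec z))
  have hval (z : M) (u v : E) :
      h z u v = g.val (sec z) (diffInvAt hπ (sec z) u) (diffInvAt hπ (sec z) v) := rfl
  have hpull (x : X) (u v : E) :
      h (pr x) (diffAt I I pr x u) (diffAt I I pr x v) = g.val x u v := by
    obtain ⟨τ, hτ, hpr, hτg, hτx⟩ := hdeck x (sec (pr x)) (hsec (pr x)).symm
    rw [hval, ← diffAt_deck hπ.contMDiff hτ hpr x u, ← diffAt_deck hπ.contMDiff hτ hpr x v,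
      ← hτx, diffInvAt_diffAt, diffInvAt_diffAt, hτg.val]
  exact ⟨h, hpull⟩

include hπ in
lemma exists_intertwines_of_isDeckTransitive (hs : Function.Surjective pr) {J : EndField I X}
    (hdeck : IsDeckTransitive I pr fun τ => Intertwines τ J J) :
    ∃ J' : EndField I M, Intertwines pr J J' := by
  obtain ⟨sec, hsec⟩ := hs.hasRightInverse
  let J' (z : M) : E →L[ℝ] E :=
    (diffAt I I pr (sec z)).comp ((J.val (sec z)).comp (diffInvAt hπ (sec z)))
  have hval (z : M) (u : E) :
      J' z u = diffAt I I pr (sec z) (J.val (sec z) (diffInvAt hπ (sec z) u)) := rfl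
  have hpush (x : X) (u : E) :
      diffAt I I pr x (J.val x u) = J' (pr x) (diffAt I I pr x u) := by
    obtain ⟨τ, hτ, hpr, hτJ, hτx⟩ := hdeck x (sec (pr x)) (hsec (pr x)).symm
    rw [hval, ← diffAt_deck hπ.contMDiff hτ hpr x u, ← hτx, diffInvAt_diffAt, ← hτJ.val,
      diffAt_deck hπ.contMDiff hτ hpr]
  exact ⟨J', hpush⟩

include hπ in
lemma IsCompatible.of_surjective (hs : Function.Surjective pr) {g : BilinField I X}
    {J : EndField I X} {h : BilinField I M} {J' : EndField I M} (hJ : IsCompatible g J)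
    (hgh : PullsBackMetric pr g h) (hJJ' : Intertwines pr J J') : IsCompatible h J' := by
  have hval (z : M) (u v : E) : h.val z (J'.val z u) (J'.val z v) = h.val z u v := by
    obtain ⟨x, rfl⟩ := hs z
    rw [← diffAt_diffInvAt hπ x u, ← diffAt_diffInvAt hπ x v, ← hJJ'.val, ← hJJ'.val, hgh.val,
      hgh.val]
    exact hJ x _ _
  exact hval

include hπ in
lemma FormField.pullback_injective (hs : Function.Surjective pr) {k : ℕ} :
    Function.Injective fun α : FormField I M k => α.pullback (I := I) pr := by
  refine fun α β hαβ => FormField.ext_val fun z v => ?_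
  obtain ⟨x, rfl⟩ := hs z
  have hval := congrArg (fun γ : FormField I X k => γ.val x fun i => diffInvAt hπ x (v i)) hαβ
  simpa only [FormField.pullback_apply, diffAt_diffInvAt] using hval

variable [IsManifold I ∞ X]

include hπ in
lemma SmoothMetric.val_self_pos_of_pullsBackMetric (hs : Function.Surjective pr)
    (g : SmoothMetric I X) {h : BilinField I M} (hgh : PullsBackMetric pr g.inner h) (z : M)
    {v : E} (hv : v ≠ 0) : 0 < h.val z v v := by
  obtain ⟨x, rfl⟩ := hs z
  rw [← diffAt_diffInvAt hπ x v, hgh.val]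
  refine g.pos x _ fun hzero => hv ?_
  rw [← diffAt_diffInvAt hπ x v]
  exact (congrArg (diffAt I I pr x) hzero).trans (map_zero _)

include hπ in
lemma SmoothMetric.isVonNBounded_unitBall_of_pullsBackMetric (hs : Function.Surjective pr)
    (g : SmoothMetric I X) {h : BilinField I M} (hgh : PullsBackMetric pr g.inner h) (z : M) :
    Bornology.IsVonNBounded ℝ {v : E | h.val z v v < 1} := by
  obtain ⟨x, rfl⟩ := hs z
  have hball : Bornology.IsVonNBounded ℝ {u : E | BilinField.val g.inner x u u < 1} :=
    g.isVonNBounded x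
  have hsub : {v : E | h.val (pr x) v v < 1} ⊆
      diffAt I I pr x '' {u : E | BilinField.val g.inner x u u < 1} := by
    refine fun v (hv : h.val (pr x) v v < 1) =>
      ⟨diffInvAt hπ x v, ?_, diffAt_diffInvAt hπ x v⟩
    change BilinField.val g.inner x _ _ < 1
    rwa [← hgh.val, diffAt_diffInvAt]
  exact (hball.image (diffAt I I pr x)).subset hsub

variable [IsManifold I ∞ M] [I.Boundaryless] [FiniteDimensional ℝ E]

/-- A tensor `h` on the base of a surjective local diffeomorphism is a smooth metric if it pulls
back to one. -/
def SmoothMetric.ofPullsBackMetric (hs : Function.Surjective pr) (g : SmoothMetric I X)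
    {h : BilinField I M} (hgh : PullsBackMetric pr g.inner h) : SmoothMetric I M where
  inner := h
  symm z u v := by
    have hsymm (a c : E) : h.val z a c = h.val z c a := by
      obtain ⟨x, rfl⟩ := hs z
      rw [← diffAt_diffInvAt hπ x a, ← diffAt_diffInvAt hπ x c, hgh.val, hgh.val]
      exact g.symm x _ _
    exact hsymm u v
  pos z _ hv := g.val_self_pos_of_pullsBackMetric hπ hs hgh z hv
  isVonNBounded z := g.isVonNBounded_unitBall_of_pullsBackMetric hπ hs hgh z
  contMDiff z := by
    obtain ⟨x, rfl⟩ := hs z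
    refine BilinField.contMDiffAt_iff.2 (BilinField.contDiffAt_inChart_of_pullback
      (hπ x).localInverse_contMDiffAt (g.contDiffAt_inChart _) ?_)
    filter_upwards [(hπ x).localInverse.open_source.mem_nhds (hπ x).localInverse_mem_source]
      with w hw using hgh.localInverse hπ hw

include hπ in
lemma IsComplexStructure.of_intertwines (hs : Function.Surjective pr) {J : EndField I X}
    {J' : EndField I M} (hJ : IsComplexStructure J) (hJJ' : Intertwines pr J J') :
    IsComplexStructure J' where
  smooth z := by
    obtain ⟨x, rfl⟩ := hs z
    have hx := (hπ x).localInverse_mem_source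
    refine EndField.contMDiffAt_iff.2 (EndField.contDiffAt_inChart_of_intertwines
      (hπ x).localInverse_contMDiffAt (hJ.contDiffAt_inChart _) ?_ ?_)
    · filter_upwards [(hπ x).localInverse.open_source.mem_nhds hx] with w hw
        using hJJ'.localInverse hπ hw
    · exact ContinuousLinearMap.IsInvertible.of_inverse
        (g := diffAt I I pr ((hπ x).localInverse (pr x)))
        (ContinuousLinearMap.ext (diffAt_localInverse_diffAt hπ hx))
        (ContinuousLinearMap.ext (diffAt_diffAt_localInverse hπ hx))
  sq z u := by
    have hsq (v : E) : J'.val z (J'.val z v) = -v := by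
      obtain ⟨x, rfl⟩ := hs z
      have hsq_above : J.val x (J.val x (diffInvAt hπ x v)) = -diffInvAt hπ x v := hJ.sq x _
      rw [← diffAt_diffInvAt hπ x v, ← hJJ'.val, ← hJJ'.val, hsq_above, map_neg,
        diffAt_diffInvAt]
    exact hsq u
  integrable z := by
    obtain ⟨x, rfl⟩ := hs z
    obtain ⟨r, φ, hφ, hφJ⟩ := hJ.integrable ((hπ x).localInverse (pr x))
    refine ⟨r, (hπ x).localInverse.trans φ, ⟨(hπ x).localInverse_mem_source, hφ⟩, ?_⟩
    rintro y ⟨hy, hyφ⟩ u j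
    have hchain (v : E) : diffAt I 𝓘(ℝ, Fin r → ℂ) ((hπ x).localInverse.trans φ) y v =
        diffAt I 𝓘(ℝ, Fin r → ℂ) φ ((hπ x).localInverse y)
          (diffAt I I (hπ x).localInverse y v) :=
      congrArg (fun L : E →L[ℝ] (Fin r → ℂ) => L v) (diffAt_comp (φ.mdifferentiableAt (by simp) hyφ)
        ((hπ x).localInverse.mdifferentiableAt (by simp) hy))
    have hpush := (hchain (J'.val y u)).trans
      (congrArg (diffAt I 𝓘(ℝ, Fin r → ℂ) φ ((hπ x).localInverse y)) (hJJ'.localInverse hπ hy u))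
    refine (congrFun hpush j).trans (Eq.trans (hφJ _ hyφ _ j) ?_)
    exact (congrArg (Complex.I * ·) (congrFun (hchain u) j)).symm

/-- The Hermitian structure induced on the base of a surjective local diffeomorphism by one
upstairs, when its metric and complex structure descend to `h` and `J'`. -/
def HermitianStructure.ofIntertwines (S : HermitianStructure I X) (hs : Function.Surjective pr)
    {h : BilinField I M} {J' : EndField I M} (hgh : PullsBackMetric pr S.metric.inner h)
    (hJ : Intertwines pr S.J J') : HermitianStructure I M where
  metric := S.metric.ofPullsBackMetric hπ hs hgh
  J := J'
  isComplex := S.isComplex.of_intertwines hπ hs hJ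
  compatible := S.compatible.of_surjective hπ hs hgh hJ

/-- The generalized Kähler structure induced on the base of a surjective local diffeomorphism by
one upstairs, when its metric and complex structures descend to `h`, `J₁` and `J₂`. -/
def GeneralizedKahlerStructure.ofIntertwines (S : GeneralizedKahlerStructure I X)
    (hs : Function.Surjective pr) {h : BilinField I M} {J₁ J₂ : EndField I M}
    (hgh : PullsBackMetric pr S.plus.metric.inner h) (hJ₁ : Intertwines pr S.plus.J J₁)
    (hJ₂ : Intertwines pr S.minus.J J₂) : GeneralizedKahlerStructure I M where
  plus := S.plus.ofIntertwines hπ hs hgh hJ₁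
  minus := S.minus.ofIntertwines hπ hs (S.same_metric ▸ hgh) hJ₂
  same_metric := rfl
  torsion_eq := by
    have hgh' : PullsBackMetric pr S.minus.metric.inner h := S.same_metric ▸ hgh
    refine FormField.pullback_injective hπ hs ?_
    refine (HermitianStructure.dcOmega_eq_pullback (S := S.plus) hπ.contMDiff hgh hJ₁).symm.trans
      (S.torsion_eq.trans ?_)
    rw [HermitianStructure.dcOmega_eq_pullback (S := S.minus)
      (T := S.minus.ofIntertwines hπ hs hgh' hJ₂) hπ.contMDiff hgh' hJ₂]
    rfl
  torsion_closed := by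
    refine FormField.pullback_injective hπ hs ?_
    change FormField.pullback pr (FormField.d _) = 0
    rw [← FormField.d_pullback (HermitianStructure.dcOmega_isDifferentiable _) hπ.contMDiff,
      ← HermitianStructure.dcOmega_eq_pullback (S := S.plus) hπ.contMDiff hgh hJ₁,
      S.torsion_closed]

include hπ in
theorem exists_generalizedKahlerStructure_of_isDeckTransitive (hs : Function.Surjective pr)
    (S : GeneralizedKahlerStructure I X)
    (hdeck : IsDeckTransitive I pr fun τ =>
      PullsBackMetric τ S.plus.metric.inner S.plus.metric.inner ∧
        Intertwines τ S.plus.J S.plus.J ∧ Intertwines τ S.minus.J S.minus.J) :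
    ∃ T : GeneralizedKahlerStructure I M,
      PullsBackMetric pr S.plus.metric.inner T.plus.metric.inner ∧
        Intertwines pr S.plus.J T.plus.J ∧ Intertwines pr S.minus.J T.minus.J := by
  obtain ⟨h, hgh⟩ := exists_pullsBackMetric_of_isDeckTransitive hπ hs
    (hdeck.mono fun _ hτ => hτ.1)
  obtain ⟨J₁, hJ₁⟩ := exists_intertwines_of_isDeckTransitive hπ hs (hdeck.mono fun _ hτ => hτ.2.1)
  obtain ⟨J₂, hJ₂⟩ := exists_intertwines_of_isDeckTransitive hπ hs (hdeck.mono fun _ hτ => hτ.2.2)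
  exact ⟨S.ofIntertwines hπ hs hgh hJ₁ hJ₂, hgh, hJ₁, hJ₂⟩

end Descent

/-! ### Frames and torsion -/

section FrameCalculus

variable {E : Type*} [NormedAddCommGroup E] [NormedSpace ℝ E]

lemma fderiv_endomorphism_of_frame {J A : E → E →L[ℝ] E} {p : E} (hJ : DifferentiableAt ℝ J p)
    (hA : DifferentiableAt ℝ A p) (hAp : ∀ v, A p v = v)
    (hinv : ∀ᶠ a in 𝓝 p, ∀ u, A a (J p u) = J a (A a u)) (X u : E) :
    fderiv ℝ J p X u = fderiv ℝ A p X (J p u) - J p (fderiv ℝ A p X u) := by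
  have heq : (fun a => J a (A a u)) =ᶠ[𝓝 p] fun a => A a (J p u) := by
    filter_upwards [hinv] with a ha using (ha u).symm
  have hleft := hJ.hasFDerivAt.clm_apply (hA.hasFDerivAt.clm_apply (hasFDerivAt_const u p))
  have hright :=
    (hA.hasFDerivAt.clm_apply (hasFDerivAt_const (J p u) p)).congr_of_eventuallyEq heq
  have hX := congrArg (fun L : E →L[ℝ] E => L X) (hleft.unique hright)
  simp only [ContinuousLinearMap.comp_zero, zero_add, add_apply, ContinuousLinearMap.comp_apply,
    ContinuousLinearMap.flip_apply, hAp] at hX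
  rw [← hX, add_sub_cancel_left]

lemma fderiv_bilinear_of_frame {g : E → E →L[ℝ] E →L[ℝ] ℝ} {A : E → E →L[ℝ] E} {p : E}
    (hg : DifferentiableAt ℝ g p) (hA : DifferentiableAt ℝ A p) (hAp : ∀ v, A p v = v)
    (hinv : ∀ᶠ a in 𝓝 p, ∀ u v, g a (A a u) (A a v) = g p u v) (X u v : E) :
    fderiv ℝ g p X u v = -g p (fderiv ℝ A p X u) v - g p u (fderiv ℝ A p X v) := by
  have heq : (fun a => g a (A a u) (A a v)) =ᶠ[𝓝 p] fun _ => g p u v := by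
    filter_upwards [hinv] with a ha using ha u v
  have hleft := (hg.hasFDerivAt.clm_apply
    (hA.hasFDerivAt.clm_apply (hasFDerivAt_const u p))).clm_apply
      (hA.hasFDerivAt.clm_apply (hasFDerivAt_const v p))
  have hX := congrArg (fun L : E →L[ℝ] ℝ => L X)
    (hleft.unique ((hasFDerivAt_const (g p u v) p).congr_of_eventuallyEq heq))
  simp only [ContinuousLinearMap.comp_zero, zero_add, add_apply, ContinuousLinearMap.comp_apply,
    ContinuousLinearMap.flip_apply, hAp, zero_apply] at hX
  linarith

/-- The Lie bracket at `p` of the vector fields `a ↦ A a u` and `a ↦ A a v`, where `A` is a frame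
which is the identity at `p`. -/
def frameBracket (A : E → E →L[ℝ] E) (p u v : E) : E :=
  fderiv ℝ A p u v - fderiv ℝ A p v u

lemma frameBracket_swap (A : E → E →L[ℝ] E) (p u v : E) :
    frameBracket A p u v = -frameBracket A p v u :=
  (neg_sub _ _).symm

lemma lieBracket_eq_frameBracket {A : E → E →L[ℝ] E} {p : E} (hA : DifferentiableAt ℝ A p)
    (hAp : ∀ v, A p v = v) (u v : E) :
    VectorField.lieBracket ℝ (fun a => A a u) (fun a => A a v) p = frameBracket A p u v := by
  have hderiv (u v : E) : fderiv ℝ (fun a => A a u) p v = fderiv ℝ A p v u := by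
    rw [(hA.hasFDerivAt.clm_apply (hasFDerivAt_const u p)).fderiv, ContinuousLinearMap.comp_zero,
      zero_add, ContinuousLinearMap.flip_apply]
  rw [VectorField.lieBracket, hderiv, hderiv, hAp, hAp, frameBracket]

theorem extDeriv_of_frame {k : ℕ} {α : E → E [⋀^Fin (k + 1)]→L[ℝ] ℝ} {A : E → E →L[ℝ] E} {p : E}
    (hα : DifferentiableAt ℝ α p) (hA : DifferentiableAt ℝ A p) (hAp : ∀ v, A p v = v)
    (hinv : ∀ᶠ a in 𝓝 p, ∀ v, α a (fun i => A a (v i)) = α p v) (v : Fin (k + 2) → E) :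
    extDeriv α p v = -∑ i : Fin (k + 1), ∑ j ≥ i, (-1) ^ (i + j : ℕ) •
      α p (Matrix.vecCons (frameBracket A p (v i.castSucc) (v j.succ))
        (j.removeNth (i.castSucc.removeNth v))) := by
  have hconst (i : Fin (k + 2)) :
      fderiv ℝ (fun a => α a (i.removeNth fun l => A a (v l))) p = 0 := by
    refine ((hasFDerivAt_const (α p (i.removeNth v)) p).congr_of_eventuallyEq ?_).fderiv
    filter_upwards [hinv] with a ha using ha (i.removeNth v)
  have hcartan := extDeriv_apply_vectorField (V := fun i a => A a (v i)) hα fun i =>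
    hA.clm_apply (differentiableAt_const (v i))
  simpa only [hAp, hconst, zero_apply, smul_zero, Finset.sum_const_zero, zero_sub,
    lieBracket_eq_frameBracket hA hAp] using hcartan

lemma extDeriv_two_form_of_frame {α : E → E [⋀^Fin 2]→L[ℝ] ℝ} {A : E → E →L[ℝ] E} {p : E}
    (hα : DifferentiableAt ℝ α p) (hA : DifferentiableAt ℝ A p) (hAp : ∀ v, A p v = v)
    (hinv : ∀ᶠ a in 𝓝 p, ∀ v, α a (fun i => A a (v i)) = α p v) (v : Fin 3 → E) :
    extDeriv α p v = -α p ![frameBracket A p (v 0) (v 1), v 2] +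
      α p ![frameBracket A p (v 0) (v 2), v 1] - α p ![frameBracket A p (v 1) (v 2), v 0] := by
  have sum_ge_zero (f : Fin 2 → ℝ) : ∑ j ≥ 0, f j = f 0 + f 1 := Fin.sum_univ_two f
  have sum_ge_one (f : Fin 2 → ℝ) : ∑ j ≥ 1, f j = f 1 := Finset.sum_singleton f 1
  have removeNth_removeNth (c : E) (i : Fin 3) (j : Fin 2) :
      Matrix.vecCons c (j.removeNth (i.removeNth v)) = ![c, v (i.succAbove (j.succAbove 0))] :=
    congrArg (Matrix.vecCons c) (funext fun l => by rw [Subsingleton.elim l 0]; rfl)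
  rw [extDeriv_of_frame hα hA hAp hinv, Fin.sum_univ_two, sum_ge_zero, sum_ge_one]
  simp only [removeNth_removeNth]
  simp
  ring

theorem nijenhuis_eq_zero_of_holomorphic {r : ℕ} {J : E → E →L[ℝ] E} {ψ : E → Fin r → ℂ} {p : E}
    (hJ : DifferentiableAt ℝ J p) (hψ : ContDiffAt ℝ ∞ ψ p)
    (hinj : Function.Injective (fderiv ℝ ψ p))
    (hhol : ∀ᶠ a in 𝓝 p, ∀ u, fderiv ℝ ψ a (J a u) = Complex.I • fderiv ℝ ψ a u) (X Y : E) :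
    fderiv ℝ J p (J p X) Y - fderiv ℝ J p (J p Y) X - J p (fderiv ℝ J p X Y) +
      J p (fderiv ℝ J p Y X) = 0 := by
  have hψ' : DifferentiableAt ℝ (fderiv ℝ ψ) p :=
    (hψ.fderiv_right (m := ∞) (by simp)).differentiableAt (by simp)
  have hsymm : IsSymmSndFDerivAt ℝ ψ p :=
    hψ.isSymmSndFDerivAt (by rw [minSmoothness_of_isRCLikeNormedField]; exact ENat.LEInfty.out)
  have hholp := hhol.self_of_nhds
  have differentiated (u v : E) : fderiv ℝ ψ p (fderiv ℝ J p u v) =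
      Complex.I • fderiv ℝ (fderiv ℝ ψ) p u v - fderiv ℝ (fderiv ℝ ψ) p u (J p v) := by
    have heq : (fun a => fderiv ℝ ψ a (J a v)) =ᶠ[𝓝 p] fun a => Complex.I • fderiv ℝ ψ a v := by
      filter_upwards [hhol] with a ha using ha v
    have hleft := hψ'.hasFDerivAt.clm_apply (hJ.hasFDerivAt.clm_apply (hasFDerivAt_const v p))
    have hright := ((hψ'.hasFDerivAt.clm_apply (hasFDerivAt_const v p)).const_smul
      Complex.I).congr_of_eventuallyEq heq
    have hu := congrArg (fun L : E →L[ℝ] (Fin r → ℂ) => L u) (hleft.unique hright)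
    simp only [ContinuousLinearMap.comp_zero, zero_add, add_apply, ContinuousLinearMap.comp_apply,
      ContinuousLinearMap.flip_apply, smul_apply] at hu
    rw [← hu, add_sub_cancel_right]
  apply hinj
  rw [map_zero, map_add, map_sub, map_sub, hholp, hholp, differentiated, differentiated,
    differentiated, differentiated, hsymm (J p Y) X, hsymm (J p Y) (J p X), hsymm (J p X) Y,
    hsymm Y X]
  simp only [smul_sub, smul_smul, Complex.I_mul_I, neg_smul, one_smul]
  abel

/-- The left side is `d^cω(u, v, w)` at a point, for the fundamental form `ω` of `(g, J)` and a
frame with bracket `c`; the hypothesis `hN` says that the Nijenhuis tensor of `J` vanishes. -/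
theorem torsion_eq_of_adInvariant {g : E →L[ℝ] E →L[ℝ] ℝ} {J : E →L[ℝ] E} {c : E → E → E}
    (hsymm : ∀ u v, g u v = g v u) (hsq : ∀ u, J (J u) = -u)
    (hcomp : ∀ u v, g (J u) (J v) = g u v) (hc : ∀ u v, c u v = -c v u)
    (had : ∀ u v w, g (c u v) w = -g v (c u w))
    (hN : ∀ u v, c (J u) (J v) = J (c (J u) v) + J (c u (J v)) + c u v) (u v w : E) :
    g (J (c (J u) (J v))) (J w) - g (J (c (J u) (J w))) (J v) + g (J (c (J v) (J w))) (J u) =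
      g (c u v) w := by
  have hskew (a b : E) : g (J a) b = -g a (J b) := by
    have := hcomp a (J b)
    rw [hsq, map_neg] at this
    linarith
  have hswap_left (a b d : E) : g (c a b) d = -g (c b a) d :=
    (congrArg (fun z => g z d) (hc a b)).trans
      (congrArg (fun L : E →L[ℝ] ℝ => L d) (map_neg g (c b a)))
  have hswap_right (a b d : E) : g (c a b) d = -g (c a d) b := by rw [had, hsymm]
  have hcyclic : g (c (J v) (J w)) u = g (c u (J v)) (J w) := by
    rw [hswap_right, hswap_left, neg_neg]
  have hNw : g (c (J u) (J v)) w =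
      -g (c (J u) v) (J w) - g (c u (J v)) (J w) + g (c u v) w := by
    rw [hN u v, map_add, map_add, add_apply, add_apply, hskew, hskew, ← sub_eq_add_neg]
  rw [hcomp, hcomp, hcomp, hNw, hcyclic, hswap_right (J u) (J w) v]
  ring

end FrameCalculus

section InvariantFrames

variable {E : Type*} [NormedAddCommGroup E] [NormedSpace ℝ E]
  {H : Type*} [TopologicalSpace H] {I : ModelWithCorners ℝ E H}
  {N : Type*} [TopologicalSpace N] [ChartedSpace H N]

/-- A frame `A` in the preferred chart at `x`, equal to the identity at `x`, in which the metric `g`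
has constant coefficients. -/
structure IsIsometricFrame (g : BilinField I N) (x : N) (A : E → E →L[ℝ] E) : Prop where
  differentiableAt : DifferentiableAt ℝ A (extChartAt I x x)
  apply_self : ∀ v, A (extChartAt I x x) v = v
  isometric : ∀ᶠ a in 𝓝 (extChartAt I x x), ∀ u v,
    g.inChart x a (A a u) (A a v) = g.val x u v

variable [IsManifold I ∞ N]

lemma EndField.inChart_self (J : EndField I N) (x : N) :
    J.inChart x (extChartAt I x x) = J.val x := by
  ext v
  rw [EndField.inChart, (extChartAt I x).left_inv (mem_extChartAt_source x),
    ContinuousLinearMap.comp_apply, coframeAt_self, ContinuousLinearMap.comp_apply, frameAt_self]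

lemma BilinField.inChart_self (g : BilinField I N) (x : N) :
    g.inChart x (extChartAt I x x) = g.val x := by
  ext u v
  rw [BilinField.inChart, (extChartAt I x).left_inv (mem_extChartAt_source x),
    ContinuousLinearMap.bilinearComp_apply, frameAt_self, frameAt_self]

variable [I.Boundaryless]

lemma SmoothMetric.frameBracket_skew (g : SmoothMetric I N) {x : N} {A B : E → E →L[ℝ] E}
    (hA : IsIsometricFrame g.inner x A) (hB : IsIsometricFrame g.inner x B)
    (hAB : ∀ u v, fderiv ℝ B (extChartAt I x x) u v = fderiv ℝ A (extChartAt I x x) v u)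
    (u v w : E) :
    BilinField.val g.inner x (frameBracket A (extChartAt I x x) u v) w =
      -BilinField.val g.inner x v (frameBracket A (extChartAt I x x) u w) := by
  have hg := (g.contDiffAt_inChart x).differentiableAt (by simp)
  have derivative_of_frame {C : E → E →L[ℝ] E} (hC : IsIsometricFrame g.inner x C) :=
    fderiv_bilinear_of_frame hg hC.differentiableAt hC.apply_self
      (by simpa only [BilinField.inChart_self] using hC.isometric) u v w
  have hAderiv := derivative_of_frame hA
  have hBderiv := derivative_of_frame hB
  rw [BilinField.inChart_self] at hAderiv hBderiv
  rw [hAB, hAB] at hBderiv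
  rw [frameBracket, frameBracket, map_sub, map_sub, sub_apply]
  linarith

lemma fderiv_comp_extChartAt_symm {F : Type*} [NormedAddCommGroup F] [NormedSpace ℝ F] {φ : N → F}
    {x₀ : N} {a : E} (ha : a ∈ (extChartAt I x₀).target)
    (hφ : MDifferentiableAt I 𝓘(ℝ, F) φ ((extChartAt I x₀).symm a)) (u : E) :
    fderiv ℝ (fun a => φ ((extChartAt I x₀).symm a)) a u =
      diffAt I 𝓘(ℝ, F) φ ((extChartAt I x₀).symm a) (frameAt I x₀ a u) := by
  have hcomp := diffAt_comp hφ (mdifferentiableAt_extChartAt_symm ha)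
  rw [← frameAt_eq_diffAt] at hcomp
  rw [← mfderiv_eq_fderiv]
  exact congrArg (fun L : E →L[ℝ] F => L u) hcomp

lemma IsComplexStructure.nijenhuis_inChart {J : EndField I N} (hJ : IsComplexStructure J) (x : N)
    (X Y : E) :
    fderiv ℝ (J.inChart x) (extChartAt I x x) (J.val x X) Y -
      fderiv ℝ (J.inChart x) (extChartAt I x x) (J.val x Y) X -
      J.val x (fderiv ℝ (J.inChart x) (extChartAt I x x) X Y) +
      J.val x (fderiv ℝ (J.inChart x) (extChartAt I x x) Y X) = 0 := by
  obtain ⟨r, φ, hxφ, hφJ⟩ := hJ.integrable x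
  have hx := (extChartAt I x).left_inv (mem_extChartAt_source x)
  have hφ {y : N} (hy : y ∈ φ.source) : ContMDiffAt I 𝓘(ℝ, Fin r → ℂ) ∞ φ y :=
    φ.contMDiffOn.contMDiffAt (φ.open_source.mem_nhds hy)
  have hderiv {a : E} (ha : a ∈ (extChartAt I x).target)
      (ha' : (extChartAt I x).symm a ∈ φ.source) (u : E) :=
    fderiv_comp_extChartAt_symm ha ((hφ ha').mdifferentiableAt (by simp)) u
  have hsmooth : ContDiffAt ℝ ∞ (fun a => φ ((extChartAt I x).symm a)) (extChartAt I x x) := by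
    rw [← contMDiffAt_iff_contDiffAt]
    refine ContMDiffAt.comp (I' := I) (g := φ) _ ?_
      (contMDiffAt_extChartAt_symm (mem_extChartAt_target x))
    rw [hx]
    exact hφ hxφ
  have hinj : Function.Injective
      (fderiv ℝ (fun a => φ ((extChartAt I x).symm a)) (extChartAt I x x)) := by
    intro u v huv
    rw [hderiv (mem_extChartAt_target x) (by rwa [hx]),
      hderiv (mem_extChartAt_target x) (by rwa [hx]), frameAt_self, frameAt_self, hx] at huv
    have hlocal : IsLocalDiffeomorphAt I 𝓘(ℝ, Fin r → ℂ) ∞ φ x := ⟨φ, hxφ, fun _ _ => rfl⟩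
    exact (hlocal.mfderivToContinuousLinearEquiv (by simp)).injective huv
  have hhol : ∀ᶠ a in 𝓝 (extChartAt I x x), ∀ u,
      fderiv ℝ (fun a => φ ((extChartAt I x).symm a)) a (J.inChart x a u) =
        Complex.I • fderiv ℝ (fun a => φ ((extChartAt I x).symm a)) a u := by
    filter_upwards [extChartAt_target_mem_nhds (I := I) x,
      tendsto_extChartAt_symm x (φ.open_source.mem_nhds hxφ)] with a ha ha' u
    rw [hderiv ha ha', hderiv ha ha', EndField.inChart, ContinuousLinearMap.comp_apply,
      frameAt_comp_coframeAt ha]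
    exact funext fun j => hφJ _ ha' (frameAt I x a u) j
  have hJdiff := (hJ.contDiffAt_inChart x).differentiableAt (by simp)
  simpa only [EndField.inChart_self] using
    nijenhuis_eq_zero_of_holomorphic hJdiff hsmooth hinj hhol X Y

lemma IsComplexStructure.frameBracket_map_map {J : EndField I N} (hJ : IsComplexStructure J)
    {x : N} {A : E → E →L[ℝ] E} (hA : DifferentiableAt ℝ A (extChartAt I x x))
    (hAx : ∀ v, A (extChartAt I x x) v = v)
    (hAJ : ∀ᶠ a in 𝓝 (extChartAt I x x), ∀ u, A a (J.val x u) = J.inChart x a (A a u)) (u v : E) :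
    letI c := frameBracket A (extChartAt I x x)
    c (J.val x u) (J.val x v) =
      J.val x (c (J.val x u) v) + J.val x (c u (J.val x v)) + c u v := by
  have hJderiv := fderiv_endomorphism_of_frame
    ((hJ.contDiffAt_inChart x).differentiableAt (by simp)) hA hAx
    (by simpa only [EndField.inChart_self] using hAJ)
  have hsq (w : E) : J.val x (J.val x w) = -w := hJ.sq x w
  have hN := hJ.nijenhuis_inChart x u v
  simp only [hJderiv, EndField.inChart_self, map_sub, hsq] at hN
  simp only [frameBracket, map_sub]
  rw [← sub_eq_zero, ← hN]
  abel

variable [FiniteDimensional ℝ E]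

theorem HermitianStructure.dcOmega_val_of_frame (S : HermitianStructure I N) {x : N}
    {A B : E → E →L[ℝ] E} (hA : IsIsometricFrame S.metric.inner x A)
    (hB : IsIsometricFrame S.metric.inner x B)
    (hAB : ∀ u v, fderiv ℝ B (extChartAt I x x) u v = fderiv ℝ A (extChartAt I x x) v u)
    (hAJ : ∀ᶠ a in 𝓝 (extChartAt I x x), ∀ u, A a (S.J.val x u) = S.J.inChart x a (A a u))
    (v : Fin 3 → E) :
    S.dcOmega.val x v = S.gval x (frameBracket A (extChartAt I x x) (v 0) (v 1)) (v 2) := by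
  have fundamentalForm_inChart_self (w : Fin 2 → E) :
      S.fundamentalForm.inChart x (extChartAt I x x) w = S.gval x (S.J.val x (w 0)) (w 1) := by
    rw [S.fundamentalForm_inChart (mem_extChartAt_target x), BilinField.inChart_self,
      EndField.inChart_self]
    rfl
  have fundamentalForm_const : ∀ᶠ a in 𝓝 (extChartAt I x x), ∀ w : Fin 2 → E,
      S.fundamentalForm.inChart x a (fun i => A a (w i)) =
        S.fundamentalForm.inChart x (extChartAt I x x) w := by
    filter_upwards [extChartAt_target_mem_nhds (I := I) x, hA.isometric, hAJ] with a ha hg hJ w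
    rw [S.fundamentalForm_inChart ha, ← hJ, hg, fundamentalForm_inChart_self]
    rfl
  have hdω := extDeriv_two_form_of_frame (S.fundamentalForm_isDifferentiable x) hA.differentiableAt
    hA.apply_self fundamentalForm_const (fun i => S.J.val x (v i))
  have htorsion := torsion_eq_of_adInvariant (g := S.gval x) (J := S.J.val x)
    (S.metric.symm x) (S.isComplex.sq x) (S.compatible x)
    (frameBracket_swap A (extChartAt I x x)) (S.metric.frameBracket_skew hA hB hAB)
    (S.isComplex.frameBracket_map_map hA.differentiableAt hA.apply_self hAJ) (v 0) (v 1) (v 2)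
  rw [dcOmega_val, FormField.d_apply]
  simp only [coframeAt_self]
  rw [hdω, ← htorsion, fundamentalForm_inChart_self, fundamentalForm_inChart_self,
    fundamentalForm_inChart_self]
  simp only [Matrix.cons_val_zero, Matrix.cons_val_one]
  ring

end InvariantFrames

lemma hasFDerivAt_fderiv_comp {V F W V' : Type*} [NormedAddCommGroup V] [NormedSpace ℝ V]
    [NormedAddCommGroup F] [NormedSpace ℝ F] [NormedAddCommGroup W] [NormedSpace ℝ W]
    [NormedAddCommGroup V'] [NormedSpace ℝ V'] {μ : F → W} {f : V → F} {f' : V →L[ℝ] F} {p : V}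
    (hμ : DifferentiableAt ℝ (fderiv ℝ μ) (f p)) (hf : HasFDerivAt f f' p) (T : V' →L[ℝ] F) :
    HasFDerivAt (fun a => (fderiv ℝ μ (f a)).comp T)
      (((ContinuousLinearMap.compL ℝ V' F W).flip T).comp
        ((fderiv ℝ (fderiv ℝ μ) (f p)).comp f')) p :=
  ((ContinuousLinearMap.compL ℝ V' F W).flip T).hasFDerivAt.comp p (hμ.hasFDerivAt.comp p hf)

/-! ### Invariant complex structures on Lie groups -/

section TranslationFrames

variable {E : Type*} [NormedAddCommGroup E] [NormedSpace ℝ E]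
  {H : Type*} [TopologicalSpace H] {I : ModelWithCorners ℝ E H}
  {N : Type*} [TopologicalSpace N] [ChartedSpace H N] [Group N]

variable (I) in
/-- The ternary operation `(y, z) ↦ y x⁻¹ z` in the preferred chart at `x`. The point `x` is neutral
for it, so that no chart around the identity of the group is needed. -/
def heapChart (x : N) (a : E × E) : E :=
  extChartAt I x ((extChartAt I x).symm a.1 * x⁻¹ * (extChartAt I x).symm a.2)

variable (I) in
/-- The frame of left-invariant vector fields in the preferred chart at `x`, equal to the identity
at `x`: at the point with coordinates `a` it is the partial differential of `heapChart`, that is,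
the differential at `x` of the left translation moving `x` to that point. -/
def leftFrame (x : N) (a : E) : E →L[ℝ] E :=
  (fderiv ℝ (heapChart I x) (a, extChartAt I x x)).comp (ContinuousLinearMap.inr ℝ E E)

variable (I) in
/-- The frame of right-invariant vector fields in the preferred chart at `x`, see `leftFrame`. -/
def rightFrame (x : N) (a : E) : E →L[ℝ] E :=
  (fderiv ℝ (heapChart I x) (extChartAt I x x, a)).comp (ContinuousLinearMap.inl ℝ E E)

section

variable [I.Boundaryless]

lemma eventually_heapChart_left (x : N) :
    ∀ᶠ b in 𝓝 (extChartAt I x x), heapChart I x (extChartAt I x x, b) = b := by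
  filter_upwards [extChartAt_target_mem_nhds (I := I) x] with b hb
  rw [heapChart, (extChartAt I x).left_inv (mem_extChartAt_source x), mul_inv_cancel, one_mul,
    (extChartAt I x).right_inv hb]

lemma eventually_heapChart_right (x : N) :
    ∀ᶠ a in 𝓝 (extChartAt I x x), heapChart I x (a, extChartAt I x x) = a := by
  filter_upwards [extChartAt_target_mem_nhds (I := I) x] with a ha
  rw [heapChart, (extChartAt I x).left_inv (mem_extChartAt_source x), inv_mul_cancel_right,
    (extChartAt I x).right_inv ha]

end

variable [I.Boundaryless] [LieGroup I ∞ N]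

lemma contDiffAt_heapChart (x : N) :
    ContDiffAt ℝ ∞ (heapChart I x) (extChartAt I x x, extChartAt I x x) := by
  have hsymm := contMDiffAt_extChartAt_symm (I := I) (mem_extChartAt_target x)
  have hfst : ContMDiffAt 𝓘(ℝ, E × E) I ∞ (fun a : E × E => (extChartAt I x).symm a.1)
      (extChartAt I x x, extChartAt I x x) :=
    ContMDiffAt.comp (I' := 𝓘(ℝ, E)) _ hsymm contDiff_fst.contMDiff.contMDiffAt
  have hsnd : ContMDiffAt 𝓘(ℝ, E × E) I ∞ (fun a : E × E => (extChartAt I x).symm a.2)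
      (extChartAt I x x, extChartAt I x x) :=
    ContMDiffAt.comp (I' := 𝓘(ℝ, E)) _ hsymm contDiff_snd.contMDiff.contMDiffAt
  rw [← contMDiffAt_iff_contDiffAt]
  refine ContMDiffAt.comp (I' := I) (g := extChartAt I x) _ ?_
    ((hfst.mul contMDiffAt_const).mul hsnd)
  simp only [(extChartAt I x).left_inv (mem_extChartAt_source x), mul_inv_cancel, one_mul]
  exact contMDiffAt_extChartAt

lemma hasFDerivAt_heapChart (x : N) :
    HasFDerivAt (heapChart I x) (fderiv ℝ (heapChart I x) (extChartAt I x x, extChartAt I x x))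
      (extChartAt I x x, extChartAt I x x) :=
  ((contDiffAt_heapChart x).differentiableAt (by simp)).hasFDerivAt

lemma differentiableAt_fderiv_heapChart (x : N) :
    DifferentiableAt ℝ (fderiv ℝ (heapChart I x)) (extChartAt I x x, extChartAt I x x) :=
  ((contDiffAt_heapChart x).fderiv_right (m := ∞) (by simp)).differentiableAt (by simp)

lemma leftFrame_self (x : N) (v : E) : leftFrame I x (extChartAt I x x) v = v := by
  have hpartial := (hasFDerivAt_heapChart (I := I) x).comp (extChartAt I x x)
    (hasFDerivAt_prodMk_right (𝕜 := ℝ) (extChartAt I x x) (extChartAt I x x))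
  have hid := (hasFDerivAt_id (𝕜 := ℝ) (extChartAt I x x)).congr_of_eventuallyEq
    (eventually_heapChart_left (I := I) x)
  exact congrArg (fun L : E →L[ℝ] E => L v) (hpartial.unique hid)

lemma rightFrame_self (x : N) (v : E) : rightFrame I x (extChartAt I x x) v = v := by
  have hpartial := HasFDerivAt.comp (f := fun a => (a, extChartAt I x x)) (extChartAt I x x)
    (hasFDerivAt_heapChart (I := I) x)
    (hasFDerivAt_prodMk_left (𝕜 := ℝ) (extChartAt I x x) (extChartAt I x x))
  have hid := (hasFDerivAt_id (𝕜 := ℝ) (extChartAt I x x)).congr_of_eventuallyEq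
    (eventually_heapChart_right (I := I) x)
  exact congrArg (fun L : E →L[ℝ] E => L v) (hpartial.unique hid)

lemma hasFDerivAt_leftFrame (x : N) :
    HasFDerivAt (leftFrame I x)
      (((ContinuousLinearMap.compL ℝ E (E × E) E).flip (ContinuousLinearMap.inr ℝ E E)).comp
        ((fderiv ℝ (fderiv ℝ (heapChart I x)) (extChartAt I x x, extChartAt I x x)).comp
          (ContinuousLinearMap.inl ℝ E E)))
      (extChartAt I x x) :=
  hasFDerivAt_fderiv_comp (f := fun a => (a, extChartAt I x x))
    (differentiableAt_fderiv_heapChart x) (hasFDerivAt_prodMk_left _ _) _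

lemma hasFDerivAt_rightFrame (x : N) :
    HasFDerivAt (rightFrame I x)
      (((ContinuousLinearMap.compL ℝ E (E × E) E).flip (ContinuousLinearMap.inl ℝ E E)).comp
        ((fderiv ℝ (fderiv ℝ (heapChart I x)) (extChartAt I x x, extChartAt I x x)).comp
          (ContinuousLinearMap.inr ℝ E E)))
      (extChartAt I x x) :=
  hasFDerivAt_fderiv_comp (f := fun a => (extChartAt I x x, a))
    (differentiableAt_fderiv_heapChart x) (hasFDerivAt_prodMk_right _ _) _

lemma fderiv_rightFrame (x : N) (u v : E) :
    fderiv ℝ (rightFrame I x) (extChartAt I x x) u v =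
      fderiv ℝ (leftFrame I x) (extChartAt I x x) v u := by
  have hsymm : IsSymmSndFDerivAt ℝ (heapChart I x) (extChartAt I x x, extChartAt I x x) :=
    (contDiffAt_heapChart x).isSymmSndFDerivAt
      (by rw [minSmoothness_of_isRCLikeNormedField]; exact ENat.LEInfty.out)
  rw [(hasFDerivAt_rightFrame x).fderiv, (hasFDerivAt_leftFrame x).fderiv]
  exact hsymm (0, u) (v, 0)

lemma eventually_differentiableAt_heapChart (x : N) :
    ∀ᶠ c in 𝓝 (extChartAt I x x, extChartAt I x x), DifferentiableAt ℝ (heapChart I x) c := by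
  have hC1 := (contDiffAt_heapChart (I := I) x).of_le (m := 1) (by simp)
  filter_upwards [hC1.eventually (by simp)] with c hc using hc.differentiableAt one_ne_zero

end TranslationFrames

section InvariantTorsion

variable {E : Type*} [NormedAddCommGroup E] [NormedSpace ℝ E]
  {H : Type*} [TopologicalSpace H] {I : ModelWithCorners ℝ E H}
  {N : Type*} [TopologicalSpace N] [ChartedSpace H N]

section FramesFromMaps

variable [IsManifold I ∞ N] {x : N} {f : N → N} {a : E} {A : E →L[ℝ] E}

omit [IsManifold I ∞ N] in
lemma BilinField.inChart_frame {g : BilinField I N} (hfx : f x = (extChartAt I x).symm a)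
    (hA : ∀ u, diffAt I I f x u = frameAt I x a (A u)) (hg : PullsBackMetric f g g) (u v : E) :
    g.inChart x a (A u) (A v) = g.val x u v := by
  rw [← hg.val x u v, hA, hA, hfx]
  rfl

lemma EndField.inChart_frame {J : EndField I N} (ha : a ∈ (extChartAt I x).target)
    (hfx : f x = (extChartAt I x).symm a) (hA : ∀ u, diffAt I I f x u = frameAt I x a (A u))
    (hJ : Intertwines f J J) (u : E) :
    A (J.val x u) = J.inChart x a (A u) := by
  have hcoframe := congrArg (coframeAt I x ((extChartAt I x).symm a)) (hJ.val x u)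
  rwa [hA, hA, hfx, coframeAt_comp_frameAt ha] at hcoframe

variable [I.Boundaryless]

lemma diffAt_eq_frameAt_fderiv (hf : MDifferentiableAt I I f x)
    (hfx : f x ∈ (extChartAt I x).source) (u : E) :
    diffAt I I f x u = frameAt I x (extChartAt I x (f x))
      (fderiv ℝ (fun b => extChartAt I x (f ((extChartAt I x).symm b))) (extChartAt I x x) u) := by
  have hx := (extChartAt I x).left_inv (mem_extChartAt_source x)
  have hsymm := mdifferentiableAt_extChartAt_symm (I := I) (mem_extChartAt_target x)
  rw [← hx] at hf
  have hcomp := diffAt_eq_frameAt_comp_fderiv (f := fun y => f ((extChartAt I x).symm y))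
    (x₀ := x) (p := extChartAt I x x) (hf.comp _ hsymm) (by rwa [hx])
  rw [diffAt_comp hf hsymm, ← frameAt_eq_diffAt, hx] at hcomp
  simpa only [ContinuousLinearMap.comp_apply, frameAt_self] using
    congrArg (fun L : E →L[ℝ] E => L u) hcomp

end FramesFromMaps

variable [Group N] [LieGroup I ∞ N] [I.Boundaryless]

lemma eventually_leftFrame (x : N) :
    ∀ᶠ a in 𝓝 (extChartAt I x x), ∀ u,
      diffAt I I (fun z => (extChartAt I x).symm a * x⁻¹ * z) x u =
        frameAt I x a (leftFrame I x a u) := by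
  have hcont : ContinuousAt (fun a : E => (a, extChartAt I x x)) (extChartAt I x x) := by fun_prop
  filter_upwards [extChartAt_target_mem_nhds (I := I) x,
    hcont.eventually (eventually_differentiableAt_heapChart (I := I) x)] with a ha hdiff u
  have hmul : (extChartAt I x).symm a * x⁻¹ * x = (extChartAt I x).symm a :=
    inv_mul_cancel_right _ _
  have hpartial := (HasFDerivAt.comp (f := fun b => (a, b)) (extChartAt I x x) hdiff.hasFDerivAt
    (hasFDerivAt_prodMk_right (𝕜 := ℝ) a (extChartAt I x x))).fderiv
  rw [diffAt_eq_frameAt_fderiv (contMDiff_mul_left.mdifferentiable (n := ∞) (by simp) x)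
    (by rw [hmul]; exact (extChartAt I x).map_target ha), hmul, (extChartAt I x).right_inv ha]
  exact congrArg (fun L : E →L[ℝ] E => frameAt I x a (L u)) hpartial

lemma eventually_rightFrame (x : N) :
    ∀ᶠ a in 𝓝 (extChartAt I x x), ∀ u,
      diffAt I I (fun z => z * (x⁻¹ * (extChartAt I x).symm a)) x u =
        frameAt I x a (rightFrame I x a u) := by
  have hcont : ContinuousAt (fun a : E => (extChartAt I x x, a)) (extChartAt I x x) := by fun_prop
  filter_upwards [extChartAt_target_mem_nhds (I := I) x,
    hcont.eventually (eventually_differentiableAt_heapChart (I := I) x)] with a ha hdiff u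
  have hmul : x * (x⁻¹ * (extChartAt I x).symm a) = (extChartAt I x).symm a :=
    mul_inv_cancel_left _ _
  have hpartial := (HasFDerivAt.comp (f := fun b => (b, a)) (extChartAt I x x) hdiff.hasFDerivAt
    (hasFDerivAt_prodMk_left (𝕜 := ℝ) (extChartAt I x x) a)).fderiv
  simp only [Function.comp_def, heapChart, mul_assoc] at hpartial
  rw [diffAt_eq_frameAt_fderiv (contMDiff_mul_right.mdifferentiable (n := ∞) (by simp) x)
    (by rw [hmul]; exact (extChartAt I x).map_target ha), hmul, (extChartAt I x).right_inv ha,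
    hpartial]
  rfl

lemma IsBiInvariantMetric.isIsometricFrame_leftFrame {g : BilinField I N}
    (hg : IsBiInvariantMetric I g) (x : N) : IsIsometricFrame g x (leftFrame I x) where
  differentiableAt := (hasFDerivAt_leftFrame x).differentiableAt
  apply_self := leftFrame_self x
  isometric := by
    filter_upwards [eventually_leftFrame (I := I) x] with a ha
    exact BilinField.inChart_frame (inv_mul_cancel_right _ _) ha (hg _).1

lemma IsBiInvariantMetric.isIsometricFrame_rightFrame {g : BilinField I N}
    (hg : IsBiInvariantMetric I g) (x : N) : IsIsometricFrame g x (rightFrame I x) where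
  differentiableAt := (hasFDerivAt_rightFrame x).differentiableAt
  apply_self := rightFrame_self x
  isometric := by
    filter_upwards [eventually_rightFrame (I := I) x] with a ha
    exact BilinField.inChart_frame (mul_inv_cancel_left _ _) ha (hg _).2

namespace HermitianStructure

variable [FiniteDimensional ℝ E]

lemma dcOmega_val_of_leftInvariant (S : HermitianStructure I N)
    (hb : IsBiInvariantMetric I S.metric.inner)
    (hJ : ∀ a : N, Intertwines (fun z => a * z) S.J S.J) (x : N) (v : Fin 3 → E) :
    S.dcOmega.val x v =
      S.gval x (frameBracket (leftFrame I x) (extChartAt I x x) (v 0) (v 1)) (v 2) := by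
  refine S.dcOmega_val_of_frame (hb.isIsometricFrame_leftFrame x)
    (hb.isIsometricFrame_rightFrame x) (fderiv_rightFrame x) ?_ v
  filter_upwards [extChartAt_target_mem_nhds (I := I) x, eventually_leftFrame (I := I) x]
    with a ha hleft
  exact EndField.inChart_frame ha (inv_mul_cancel_right _ _) hleft (hJ _)

lemma dcOmega_val_of_rightInvariant (S : HermitianStructure I N)
    (hb : IsBiInvariantMetric I S.metric.inner)
    (hJ : ∀ a : N, Intertwines (fun z => z * a) S.J S.J) (x : N) (v : Fin 3 → E) :
    S.dcOmega.val x v =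
      S.gval x (frameBracket (rightFrame I x) (extChartAt I x x) (v 0) (v 1)) (v 2) := by
  refine S.dcOmega_val_of_frame (hb.isIsometricFrame_rightFrame x)
    (hb.isIsometricFrame_leftFrame x) (fun u v => (fderiv_rightFrame x v u).symm) ?_ v
  filter_upwards [extChartAt_target_mem_nhds (I := I) x, eventually_rightFrame (I := I) x]
    with a ha hright
  exact EndField.inChart_frame ha (mul_inv_cancel_left _ _) hright (hJ _)

theorem dcOmega_eq_neg_of_invariant {S T : HermitianStructure I N} (hST : S.metric = T.metric)
    (hb : IsBiInvariantMetric I S.metric.inner)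
    (hS : ∀ a : N, Intertwines (fun z => z * a) S.J S.J)
    (hT : ∀ a : N, Intertwines (fun z => a * z) T.J T.J) :
    S.dcOmega = -T.dcOmega := by
  refine FormField.ext_val fun x v => (S.dcOmega_val_of_rightInvariant hb hS x v).trans ?_
  have hbracket : frameBracket (rightFrame I x) (extChartAt I x x) (v 0) (v 1) =
      -frameBracket (leftFrame I x) (extChartAt I x x) (v 0) (v 1) := by
    rw [frameBracket, frameBracket, fderiv_rightFrame, fderiv_rightFrame, neg_sub]
  have hmetric : S.gval x = T.gval x := by rw [gval, gval, hST]
  have hleft := T.dcOmega_val_of_leftInvariant (hST ▸ hb) hT x v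
  rw [hbracket, hmetric, map_neg, neg_apply, ← hleft]
  rfl

end HermitianStructure

end InvariantTorsion

section BiInvariantForms

variable {E : Type*} [NormedAddCommGroup E] [NormedSpace ℝ E]
  {H : Type*} [TopologicalSpace H] {I : ModelWithCorners ℝ E H}
  {N : Type*} [TopologicalSpace N] [ChartedSpace H N]

namespace FormField

variable {k : ℕ}

lemma pullback_pullback {E' : Type*} [NormedAddCommGroup E'] [NormedSpace ℝ E']
    {H' : Type*} [TopologicalSpace H'] {I' : ModelWithCorners ℝ E' H'}
    {N' : Type*} [TopologicalSpace N'] [ChartedSpace H' N']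
    {E'' : Type*} [NormedAddCommGroup E''] [NormedSpace ℝ E'']
    {H'' : Type*} [TopologicalSpace H''] {I'' : ModelWithCorners ℝ E'' H''}
    {N'' : Type*} [TopologicalSpace N''] [ChartedSpace H'' N''] (α : FormField I'' N'' k)
    {g : N' → N''} {f : N → N'} (hg : MDifferentiable I' I'' g) (hf : MDifferentiable I I' f) :
    (α.pullback (I := I') g).pullback (I := I) f = α.pullback fun x => g (f x) := by
  refine ext_val fun x v => ?_
  simp only [pullback_apply, diffAt_comp (hg (f x)) (hf x), ContinuousLinearMap.comp_apply]

lemma d_neg [I.Boundaryless] [IsManifold I ∞ N] (α : FormField I N k) :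
    FormField.d (-α) = -α.d := by
  refine ext_val fun x v => (d_apply (-α) x v).trans ?_
  refine Eq.trans ?_ (congrArg Neg.neg (d_apply α x v)).symm
  have hinChart : (-α).inChart x = -α.inChart x := rfl
  have hextDeriv : extDeriv (-α.inChart x) (extChartAt I x x) =
      -extDeriv (α.inChart x) (extChartAt I x x) := by
    simp only [extDeriv, fderiv_neg]
    exact map_neg (ContinuousAlternatingMap.alternatizeUncurryFinCLM ℝ E ℝ) _
  rw [hinChart, hextDeriv, ContinuousAlternatingMap.neg_apply]

lemma val_neg (α : FormField I N k) (x : N) (v : Fin k → E) :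
    α.val x (fun i => -v i) = (-1) ^ k * α.val x v := by
  simpa using (α.val x).toMultilinearMap.map_smul_univ (fun _ => (-1 : ℝ)) v

end FormField

variable [Group N]

/-- The inversion of the group, translated so as to fix `x`. For a bi-invariant metric it is the
geodesic symmetry at `x`. -/
def inversionAt (x y : N) : N := x * y⁻¹ * x

omit [TopologicalSpace N] in
lemma inversionAt_self (x : N) : inversionAt x x = x := by
  rw [inversionAt, mul_inv_cancel, one_mul]

omit [TopologicalSpace N] in
lemma inversionAt_eq_translate (x y z : N) :
    inversionAt x z = x * y⁻¹ * inversionAt y z * (y⁻¹ * x) := by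
  rw [inversionAt, inversionAt]
  group

variable [LieGroup I ∞ N]

variable (I) in
lemma contMDiff_inversionAt (x : N) : ContMDiff I I ∞ (inversionAt x) :=
  (contMDiff_const.mul (contMDiff_inv I ∞)).mul contMDiff_const

variable (I) in
lemma diffAt_inversionAt_self (x : N) (u : E) : diffAt I I (inversionAt x) x u = -u := by
  let heap : N × N → N := fun a => a.1 * x⁻¹ * a.2
  have hheap : MDifferentiableAt (I.prod I) I heap (x, x) :=
    ((contMDiff_fst.mul contMDiff_const).mul contMDiff_snd).mdifferentiable (n := ∞) (by simp) _
  have hinv : MDifferentiableAt I I (inversionAt x) x :=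
    (contMDiff_inversionAt I x).mdifferentiable (by simp) x
  have hconst : (fun z => heap (z, inversionAt x z)) = fun _ => x :=
    funext fun z => by simp only [heap, inversionAt]; group
  have hheap_diff (u v : E) : diffAt (I.prod I) I heap (x, x) (u, v) = u + v := by
    have hfst : (fun z => heap (z, x)) = fun z => z :=
      funext fun z => inv_mul_cancel_right z x
    have hsnd : (fun z => heap (x, z)) = fun z => z :=
      funext fun z => by simp only [heap, mul_inv_cancel, one_mul]
    have hadd : diffAt (I.prod I) I heap (x, x) (u, v) =
        diffAt I I (fun z => heap (z, x)) x u + diffAt I I (fun z => heap (x, z)) x v :=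
      mfderiv_prod_eq_add_apply hheap
    rw [hadd, hfst, hsnd, diffAt_id]
    rfl
  have hprod : diffAt I (I.prod I) (fun z => (z, inversionAt x z)) x =
      (diffAt I I (fun z => z) x).prod (diffAt I I (inversionAt x) x) :=
    mfderiv_prodMk mdifferentiableAt_id hinv
  have hcomp := diffAt_comp (I' := I.prod I) (g := heap) (f := fun z => (z, inversionAt x z))
    (x := x) (by rwa [inversionAt_self]) (mdifferentiableAt_id.prodMk hinv)
  have hzero : diffAt I I (fun _ : N => x) x = 0 := mfderiv_const
  rw [hconst, hzero, hprod, inversionAt_self, diffAt_id] at hcomp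
  have hsum := congrArg (fun L : E →L[ℝ] E => L u) hcomp
  exact (neg_eq_of_add_eq_zero_right ((hheap_diff u _).symm.trans hsum.symm)).symm

lemma FormField.pullback_inversionAt_of_biInvariant {k : ℕ} (hk : Odd k) {α : FormField I N k}
    (hl : ∀ a : N, α = α.pullback fun z => a * z) (hr : ∀ a : N, α = α.pullback fun z => z * a)
    (x : N) : α.pullback (inversionAt x) = -α := by
  refine FormField.ext_val fun y v => ?_
  have hleft (a : N) : MDifferentiable I I fun z => a * z :=
    (contMDiff_mul_left (n := ∞)).mdifferentiable (by simp)
  have hright (a : N) : MDifferentiable I I fun z => z * a :=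
    (contMDiff_mul_right (n := ∞)).mdifferentiable (by simp)
  have hinv : MDifferentiable I I (inversionAt y) :=
    (contMDiff_inversionAt I y).mdifferentiable (by simp)
  have htranslation : MDifferentiable I I fun z => x * y⁻¹ * z * (y⁻¹ * x) :=
    (hright _).comp (hleft _)
  have htranslate : α.pullback (inversionAt x) = α.pullback (I := I) (inversionAt y) := by
    conv_rhs => rw [hl (x * y⁻¹), hr (y⁻¹ * x)]
    rw [FormField.pullback_pullback _ (hright _) (hleft _),
      FormField.pullback_pullback _ htranslation hinv]
    exact congrArg α.pullback (funext (inversionAt_eq_translate x y))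
  rw [htranslate, FormField.pullback_apply, inversionAt_self]
  simp only [diffAt_inversionAt_self]
  rw [FormField.val_neg, hk.neg_one_pow, neg_one_mul]
  rfl

variable [I.Boundaryless]

theorem FormField.d_eq_zero_of_biInvariant {k : ℕ} (hk : Odd k) {α : FormField I N k}
    (hα : α.IsDifferentiable) (hl : ∀ a : N, α = α.pullback fun z => a * z)
    (hr : ∀ a : N, α = α.pullback fun z => z * a) : α.d = 0 := by
  refine FormField.ext_val fun x v => ?_
  have hd := FormField.d_pullback hα (contMDiff_inversionAt I x)
  rw [FormField.pullback_inversionAt_of_biInvariant hk hl hr, FormField.d_neg] at hd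
  have heven : (α.d.pullback (I := I) (inversionAt x)).val x v = α.d.val x v := by
    rw [FormField.pullback_apply, inversionAt_self]
    simp only [diffAt_inversionAt_self]
    rw [FormField.val_neg, hk.add_one.neg_one_pow, one_mul]
  rw [← hd] at heven
  exact CharZero.neg_eq_self_iff.1 heven

variable [FiniteDimensional ℝ E]

theorem HermitianStructure.d_dcOmega_of_invariant {S T : HermitianStructure I N}
    (hST : S.metric = T.metric) (hb : IsBiInvariantMetric I S.metric.inner)
    (hS : ∀ a : N, Intertwines (fun z => z * a) S.J S.J)
    (hT : ∀ a : N, Intertwines (fun z => a * z) T.J T.J) :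
    FormField.d S.dcOmega = 0 := by
  have hneg := dcOmega_eq_neg_of_invariant hST hb hS hT
  refine FormField.d_eq_zero_of_biInvariant (by decide) S.dcOmega_isDifferentiable (fun a => ?_)
    fun a => dcOmega_eq_pullback contMDiff_mul_right (hb a).2 (hS a)
  have hleft := dcOmega_eq_pullback contMDiff_mul_left ((hST ▸ hb) a).1 (hT a)
  rw [hneg]
  exact congrArg Neg.neg hleft

/-- The generalized Kähler structure on a Lie group given by a right-invariant structure `S` and a
left-invariant structure `T` with the same bi-invariant metric. -/
def GeneralizedKahlerStructure.ofInvariant (S T : HermitianStructure I N)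
    (hST : S.metric = T.metric) (hb : IsBiInvariantMetric I S.metric.inner)
    (hS : ∀ a : N, Intertwines (fun z => z * a) S.J S.J)
    (hT : ∀ a : N, Intertwines (fun z => a * z) T.J T.J) :
    GeneralizedKahlerStructure I N where
  plus := S
  minus := T
  same_metric := hST
  torsion_eq := HermitianStructure.dcOmega_eq_neg_of_invariant hST hb hS hT
  torsion_closed := HermitianStructure.d_dcOmega_of_invariant hST hb hS hT

end BiInvariantForms

section ProdMap

variable {E : Type*} [NormedAddCommGroup E] [NormedSpace ℝ E]
  {H : Type*} [TopologicalSpace H] {I : ModelWithCorners ℝ E H}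
  {M : Type*} [TopologicalSpace M] [ChartedSpace H M]
  {E' : Type*} [NormedAddCommGroup E'] [NormedSpace ℝ E']
  {H' : Type*} [TopologicalSpace H'] {I' : ModelWithCorners ℝ E' H'}
  {M' : Type*} [TopologicalSpace M'] [ChartedSpace H' M']
  {f : M → M} {f' : M' → M'}

lemma prodEnd_val (J : EndField I M) (J' : EndField I' M') (x : M × M') (u : E × E') :
    (prodEnd J J').val x u = (J.val x.1 u.1, J'.val x.2 u.2) := rfl

lemma diffAt_prodMap {x : M × M'} (hf : MDifferentiableAt I I f x.1)
    (hf' : MDifferentiableAt I' I' f' x.2) (u : E × E') :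
    diffAt (I.prod I') (I.prod I') (fun x : M × M' => (f x.1, f' x.2)) x u =
      (diffAt I I f x.1 u.1, diffAt I' I' f' x.2 u.2) := by
  have hprod : diffAt (I.prod I') (I.prod I') (fun x : M × M' => (f x.1, f' x.2)) x =
      (diffAt I I f x.1).prodMap (diffAt I' I' f' x.2) := mfderiv_prodMap hf hf'
  rw [hprod]
  rfl

lemma PullsBackMetric.prodMap (hf : MDifferentiable I I f) (hf' : MDifferentiable I' I' f')
    {g : BilinField I M} {g' : BilinField I' M'}
    (h : PullsBackMetric f g g) (h' : PullsBackMetric f' g' g') :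
    PullsBackMetric (fun x : M × M' => (f x.1, f' x.2)) (prodBilin g g') (prodBilin g g') := by
  intro x
  have hval (u v : E × E') : (prodBilin g g').val (f x.1, f' x.2)
      (diffAt (I.prod I') (I.prod I') (fun x : M × M' => (f x.1, f' x.2)) x u)
      (diffAt (I.prod I') (I.prod I') (fun x : M × M' => (f x.1, f' x.2)) x v) =
        (prodBilin g g').val x u v := by
    rw [diffAt_prodMap (hf _) (hf' _), diffAt_prodMap (hf _) (hf' _), prodBilin_val,
      prodBilin_val, h.val, h'.val]
  exact hval

lemma Intertwines.prodMap (hf : MDifferentiable I I f) (hf' : MDifferentiable I' I' f')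
    {J : EndField I M} {J' : EndField I' M'}
    (h : Intertwines f J J) (h' : Intertwines f' J' J') :
    Intertwines (fun x : M × M' => (f x.1, f' x.2)) (prodEnd J J') (prodEnd J J') := by
  intro x
  have hval (u : E × E') :
      diffAt (I.prod I') (I.prod I') (fun x : M × M' => (f x.1, f' x.2)) x
        ((prodEnd J J').val x u) = (prodEnd J J').val (f x.1, f' x.2)
          (diffAt (I.prod I') (I.prod I') (fun x : M × M' => (f x.1, f' x.2)) x u) := by
    rw [diffAt_prodMap (hf _) (hf' _), diffAt_prodMap (hf _) (hf' _), prodEnd_val, prodEnd_val,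
      h.val, h'.val]
  exact hval

variable [FiniteDimensional ℝ E] [I.Boundaryless] [IsManifold I ∞ M]
  [FiniteDimensional ℝ E'] [I'.Boundaryless] [IsManifold I' ∞ M']

/-- The product of a Kähler manifold and a generalized Kähler manifold. -/
def HermitianStructure.prodGeneralizedKahler (S : HermitianStructure I M) (hS : S.IsKahler)
    (T : GeneralizedKahlerStructure I' M') :
    GeneralizedKahlerStructure (I.prod I') (M × M') where
  plus := S.prod T.plus
  minus := S.prod T.minus
  same_metric := congrArg S.metric.prod T.same_metric
  torsion_eq := by
    rw [prod_dcOmega_of_isKahler _ hS, prod_dcOmega_of_isKahler _ hS, T.torsion_eq]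
    rfl
  torsion_closed := by
    rw [prod_dcOmega_of_isKahler _ hS,
      FormField.d_pullback T.plus.dcOmega_isDifferentiable contMDiff_snd, T.torsion_closed]
    rfl

end ProdMap

section VectorGroup

variable {n : ℕ}

variable (n) in
/-- The Euclidean metric `euclideanBilin n`, as a smooth metric. -/
def euclideanMetric :
    SmoothMetric 𝓘(ℝ, EuclideanSpace ℝ (Fin n)) (EuclideanSpace ℝ (Fin n)) where
  inner := euclideanBilin n
  symm := (riemannianMetricVectorSpace (EuclideanSpace ℝ (Fin n))).symm
  pos := (riemannianMetricVectorSpace (EuclideanSpace ℝ (Fin n))).pos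
  isVonNBounded := (riemannianMetricVectorSpace (EuclideanSpace ℝ (Fin n))).isVonNBounded
  contMDiff := (riemannianMetricVectorSpace (EuclideanSpace ℝ (Fin n))).contMDiff.of_le le_top

lemma pullsBackMetric_add_const (a : EuclideanSpace ℝ (Fin n)) :
    PullsBackMetric (fun t => t + a) (euclideanBilin n) (euclideanBilin n) := by
  intro x
  have hdiff : mfderiv 𝓘(ℝ, EuclideanSpace ℝ (Fin n)) 𝓘(ℝ, EuclideanSpace ℝ (Fin n))
      (fun t => t + a) x = ContinuousLinearMap.id ℝ _ := by
    rw [mfderiv_eq_fderiv, fderiv_add_const]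
    exact fderiv_id
  rw [hdiff]
  exact fun _ _ => rfl

lemma pullsBackMetric_const_add (a : EuclideanSpace ℝ (Fin n)) :
    PullsBackMetric (fun t => a + t) (euclideanBilin n) (euclideanBilin n) := by
  simpa only [add_comm a] using pullsBackMetric_add_const a

/-- The product of a multiplicative and an additive group, as a multiplicative group. -/
abbrev prodVectorGroup (G V : Type*) [Group G] [AddCommGroup V] : Group (G × V) where
  mul a b := (a.1 * b.1, a.2 + b.2)
  one := (1, 0)
  inv a := (a.1⁻¹, -a.2)
  mul_assoc _ _ _ := Prod.ext (mul_assoc _ _ _) (add_assoc _ _ _)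
  one_mul _ := Prod.ext (one_mul _) (zero_add _)
  mul_one _ := Prod.ext (mul_one _) (add_zero _)
  inv_mul_cancel _ := Prod.ext (inv_mul_cancel _) (neg_add_cancel _)

variable {E : Type*} [NormedAddCommGroup E] [NormedSpace ℝ E]
  {H : Type*} [TopologicalSpace H] {I : ModelWithCorners ℝ E H}
  {G : Type*} [TopologicalSpace G] [ChartedSpace H G] [Group G] [LieGroup I ∞ G]

variable (I G) in
lemma lieGroup_prodVectorGroup (V : Type*) [NormedAddCommGroup V] [NormedSpace ℝ V] :
    letI := prodVectorGroup G V
    LieGroup (I.prod 𝓘(ℝ, V)) ∞ (G × V) := by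
  let := prodVectorGroup G V
  have : IsManifold (I.prod 𝓘(ℝ, V)) ∞ (G × V) := inferInstance
  refine { contMDiff_mul := ?_, contMDiff_inv := ?_ }
  · exact ContMDiff.prodMk
      ((contMDiff_fst.comp contMDiff_fst).mul (contMDiff_fst.comp contMDiff_snd))
      ((contMDiff_snd.comp contMDiff_fst).add (contMDiff_snd.comp contMDiff_snd))
  · exact ContMDiff.prodMk contMDiff_fst.inv contMDiff_snd.neg

lemma isBiInvariantMetric_prod {b : BilinField I G} (hb : IsBiInvariantMetric I b) :
    letI := prodVectorGroup G (EuclideanSpace ℝ (Fin n))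
    IsBiInvariantMetric (I.prod 𝓘(ℝ, EuclideanSpace ℝ (Fin n)))
      (prodBilin b (euclideanBilin n)) := by
  let := prodVectorGroup G (EuclideanSpace ℝ (Fin n))
  have hleft (a : G) : MDifferentiable I I fun z => a * z :=
    (contMDiff_mul_left (n := ∞)).mdifferentiable (by simp)
  have hright (a : G) : MDifferentiable I I fun z => z * a :=
    (contMDiff_mul_right (n := ∞)).mdifferentiable (by simp)
  exact fun a => ⟨PullsBackMetric.prodMap (hleft a.1)
      ((differentiable_id.const_add a.2).mdifferentiable) (hb a.1).1
      (pullsBackMetric_const_add a.2),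
    PullsBackMetric.prodMap (hright a.1) ((differentiable_id.add_const a.2).mdifferentiable)
      (hb a.1).2 (pullsBackMetric_add_const a.2)⟩

variable [FiniteDimensional ℝ E] [I.Boundaryless]

/-- The generalized Kähler structure on `G × ℝⁿ` with metric `b + g_E`, given by a right-invariant
complex structure `JR` (the structure `I₊`) and a left-invariant one `JL` (the structure `I₋`). -/
def GeneralizedKahlerStructure.ofInvariantProd {b : SmoothMetric I G}
    (hb : IsBiInvariantMetric I b.inner)
    {JL JR : EndField (I.prod 𝓘(ℝ, EuclideanSpace ℝ (Fin n))) (G × EuclideanSpace ℝ (Fin n))}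
    (hJL : IsComplexStructure JL) (hJR : IsComplexStructure JR)
    (hJLg : IsCompatible (prodBilin b.inner (euclideanBilin n)) JL)
    (hJRg : IsCompatible (prodBilin b.inner (euclideanBilin n)) JR)
    (hJLinv : IsLeftInvariant JL) (hJRinv : IsRightInvariant JR) :
    GeneralizedKahlerStructure (I.prod 𝓘(ℝ, EuclideanSpace ℝ (Fin n)))
      (G × EuclideanSpace ℝ (Fin n)) :=
  letI := prodVectorGroup G (EuclideanSpace ℝ (Fin n))
  haveI := lieGroup_prodVectorGroup I G (EuclideanSpace ℝ (Fin n))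
  ofInvariant ⟨b.prod (euclideanMetric n), JR, hJR, hJRg⟩
    ⟨b.prod (euclideanMetric n), JL, hJL, hJLg⟩ rfl (isBiInvariantMetric_prod hb) hJRinv hJLinv

end VectorGroup

/-! ### The lattice action -/

section Lattice

variable {n : ℕ}

lemma latticeVec_injective :
    Function.Injective (latticeVec : Multiplicative (Fin n → ℤ) → EuclideanSpace ℝ (Fin n)) := by
  intro m m' h
  refine Multiplicative.toAdd.injective (funext fun i => ?_)
  exact Int.cast_injective (congrArg (fun v : EuclideanSpace ℝ (Fin n) => v i) h)

lemma latticeVec_one : latticeVec (1 : Multiplicative (Fin n → ℤ)) = 0 := by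
  ext
  exact Int.cast_zero

lemma finite_norm_latticeVec_le (R : ℝ) :
    {m : Multiplicative (Fin n → ℤ) | ‖latticeVec m‖ ≤ R}.Finite := by
  have hbox : Set.Finite (Set.pi Set.univ fun _ : Fin n => Set.Icc (-⌈R⌉) ⌈R⌉) :=
    Set.Finite.pi fun _ => Set.finite_Icc _ _
  refine (hbox.preimage Multiplicative.toAdd.injective.injOn).subset fun m hm i _ => ?_
  have hcoord : |((Multiplicative.toAdd m i : ℤ) : ℝ)| ≤ R :=
    (PiLp.norm_apply_le (latticeVec m) i).trans hm
  have hceil := abs_le.1 (hcoord.trans (Int.le_ceil R))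
  exact ⟨by exact_mod_cast hceil.1, by exact_mod_cast hceil.2⟩

variable {K G : Type*} {A : Subgroup (Equiv.Perm K)} {B : Subgroup (Equiv.Perm G)}
  (ψ : Multiplicative (Fin n → ℤ) →* A) (ρ : Multiplicative (Fin n → ℤ) →* B)

lemma eq_one_of_latticeAction_smul_eq (m : Multiplicative (Fin n → ℤ))
    (x : K × G × EuclideanSpace ℝ (Fin n)) (h : (latticeAction ψ ρ).smul m x = x) : m = 1 := by
  have hshift : x.2.2 + latticeVec m = x.2.2 := congrArg (fun y => y.2.2) h
  exact latticeVec_injective ((add_eq_left.1 hshift).trans latticeVec_one.symm)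

lemma latticeQuotient_mk_surjective : Function.Surjective (LatticeQuotient.mk ψ ρ) :=
  Quotient.mk_surjective

lemma latticeQuotient_mk_eq_iff {x y : K × G × EuclideanSpace ℝ (Fin n)} :
    LatticeQuotient.mk ψ ρ x = LatticeQuotient.mk ψ ρ y ↔
      ∃ m, ((ψ m : Equiv.Perm K) x.1, (ρ m : Equiv.Perm G) x.2.1, x.2.2 + latticeVec m) = y := by
  let := latticeAction ψ ρ
  exact Quotient.eq''.trans ((MulAction.orbitRel _ _).comm'.trans Iff.rfl)

variable [TopologicalSpace K] [TopologicalSpace G]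

lemma properlyDiscontinuousSMul_latticeAction :
    letI := latticeAction ψ ρ
    ProperlyDiscontinuousSMul (Multiplicative (Fin n → ℤ))
      (K × G × EuclideanSpace ℝ (Fin n)) := by
  let := latticeAction ψ ρ
  refine ⟨fun {C D} hC hD => ?_⟩
  have hcont : Continuous fun x : K × G × EuclideanSpace ℝ (Fin n) => x.2.2 := by fun_prop
  obtain ⟨R, hR⟩ := (hC.image hcont).isBounded.exists_norm_le
  obtain ⟨R', hR'⟩ := (hD.image hcont).isBounded.exists_norm_le
  refine (finite_norm_latticeVec_le (R' + R)).subset ?_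
  rintro m ⟨-, ⟨x, hx, rfl⟩, hmx⟩
  have hle : ‖x.2.2‖ ≤ R := hR _ ⟨x, hx, rfl⟩
  have hle' : ‖x.2.2 + latticeVec m‖ ≤ R' := hR' _ ⟨_, hmx, rfl⟩
  calc ‖latticeVec m‖ = ‖(x.2.2 + latticeVec m) - x.2.2‖ := by rw [add_sub_cancel_left]
    _ ≤ ‖x.2.2 + latticeVec m‖ + ‖x.2.2‖ := norm_sub_le _ _
    _ ≤ R' + R := add_le_add hle' hle

variable {ψ ρ} in
theorem latticeQuotient_topology [T2Space K] [T2Space G] [LocallyCompactSpace K]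
    [LocallyCompactSpace G] [SecondCountableTopology K] [SecondCountableTopology G]
    (hψ : ∀ m, Continuous (ψ m : Equiv.Perm K)) (hρ : ∀ m, Continuous (ρ m : Equiv.Perm G)) :
    T2Space (LatticeQuotient ψ ρ) ∧ SecondCountableTopology (LatticeQuotient ψ ρ) ∧
      IsLocalHomeomorph (LatticeQuotient.mk ψ ρ) := by
  let := latticeAction ψ ρ
  have := properlyDiscontinuousSMul_latticeAction ψ ρ
  have : ContinuousConstSMul (Multiplicative (Fin n → ℤ)) (K × G × EuclideanSpace ℝ (Fin n)) :=
    ⟨fun m => ((hψ m).comp continuous_fst).prodMk (((hρ m).comp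
      (continuous_fst.comp continuous_snd)).prodMk
        ((continuous_snd.comp continuous_snd).add continuous_const))⟩
  have : IsCancelSMul (Multiplicative (Fin n → ℤ)) (K × G × EuclideanSpace ℝ (Fin n)) :=
    isCancelSMul_iff_eq_one_of_smul_eq.2 (eq_one_of_latticeAction_smul_eq ψ ρ)
  exact ⟨t2Space_of_properlyDiscontinuousSMul_of_t2Space,
    ContinuousConstSMul.secondCountableTopology (Γ := Multiplicative (Fin n → ℤ)),
    (isQuotientCoveringMap_quotientMk_of_properlyDiscontinuousSMul
      (G := Multiplicative (Fin n → ℤ))).isCoveringMap.isLocalHomeomorph⟩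

variable {E : Type*} [NormedAddCommGroup E] [NormedSpace ℝ E]
  {H : Type*} [TopologicalSpace H] {I : ModelWithCorners ℝ E H} [ChartedSpace H K]
  {E' : Type*} [NormedAddCommGroup E'] [NormedSpace ℝ E']
  {H' : Type*} [TopologicalSpace H'] {I' : ModelWithCorners ℝ E' H'} [ChartedSpace H' G]

variable {ψ ρ} in
lemma isDeckTransitive_latticeQuotient_mk {P : (K × G × EuclideanSpace ℝ (Fin n) → _) → Prop}
    (hψ : ∀ m, ContMDiff I I ∞ (ψ m : Equiv.Perm K))
    (hρ : ∀ m, ContMDiff I' I' ∞ (ρ m : Equiv.Perm G))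
    (hP : ∀ m, P fun x =>
      ((ψ m : Equiv.Perm K) x.1, (ρ m : Equiv.Perm G) x.2.1, x.2.2 + latticeVec m)) :
    IsDeckTransitive (I.prod (I'.prod 𝓘(ℝ, EuclideanSpace ℝ (Fin n))))
      (LatticeQuotient.mk ψ ρ) P := fun x y hxy => by
  obtain ⟨m, rfl⟩ := (latticeQuotient_mk_eq_iff ψ ρ).1 hxy
  exact ⟨_, ((hψ m).comp contMDiff_fst).prodMk
      (((hρ m).comp (contMDiff_fst.comp contMDiff_snd)).prodMk
        ((contMDiff_snd.comp contMDiff_snd).add contMDiff_const)),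
    fun z => ((latticeQuotient_mk_eq_iff ψ ρ).2 ⟨m, rfl⟩).symm, hP m, rfl⟩

end Lattice

end

theorem mainTheorem8_general
    {EK : Type*} [NormedAddCommGroup EK] [NormedSpace ℝ EK] [FiniteDimensional ℝ EK]
    {HK : Type*} [TopologicalSpace HK] {IK : ModelWithCorners ℝ EK HK} [IK.Boundaryless]
    {K : Type*} [TopologicalSpace K] [ChartedSpace HK K] [IsManifold IK ∞ K]
    [T2Space K] [SecondCountableTopology K]
    (gJ : HermitianStructure IK K) (hKahler : gJ.IsKahler)
    {EG : Type*} [NormedAddCommGroup EG] [NormedSpace ℝ EG] [FiniteDimensional ℝ EG]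
    {HG : Type*} [TopologicalSpace HG] {IG : ModelWithCorners ℝ EG HG} [IG.Boundaryless]
    {G : Type*} [TopologicalSpace G] [ChartedSpace HG G] [Group G] [LieGroup IG ∞ G]
    [T2Space G] [SecondCountableTopology G]
    (b : SmoothMetric IG G) (hb : IsBiInvariantMetric IG b.inner) (n : ℕ)
    (JL JR : EndField (IG.prod 𝓘(ℝ, EuclideanSpace ℝ (Fin n))) (G × EuclideanSpace ℝ (Fin n)))
    (hJL : IsComplexStructure JL) (hJR : IsComplexStructure JR)
    (hJLg : IsCompatible (prodBilin b.inner (euclideanBilin n)) JL)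
    (hJRg : IsCompatible (prodBilin b.inner (euclideanBilin n)) JR)
    (hJLinv : IsLeftInvariant JL) (hJRinv : IsRightInvariant JR)
    (ψ : Multiplicative (Fin n → ℤ) →* holIsomGroup gJ)
    (ρ : Multiplicative (Fin n → ℤ) →* isomGroup b)
    (hρL : ∀ m, Intertwines
      (fun x : G × EuclideanSpace ℝ (Fin n) => ((ρ m : Equiv.Perm G) x.1, x.2 + latticeVec m))
      JL JL)
    (hρR : ∀ m, Intertwines
      (fun x : G × EuclideanSpace ℝ (Fin n) => ((ρ m : Equiv.Perm G) x.1, x.2 + latticeVec m))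
      JR JR) :
    (letI := latticeAction ψ ρ;
      (∀ (m : Multiplicative (Fin n → ℤ)) (x : K × G × EuclideanSpace ℝ (Fin n)),
        m • x = x → m = 1) ∧
      ProperlyDiscontinuousSMul (Multiplicative (Fin n → ℤ))
        (K × G × EuclideanSpace ℝ (Fin n))) ∧
    T2Space (LatticeQuotient ψ ρ) ∧ SecondCountableTopology (LatticeQuotient ψ ρ) ∧
    ∃ (_ : ChartedSpace (ModelProd HK (ModelProd HG (EuclideanSpace ℝ (Fin n))))
        (LatticeQuotient ψ ρ))
      (_ : IsManifold (IK.prod (IG.prod 𝓘(ℝ, EuclideanSpace ℝ (Fin n)))) ∞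
        (LatticeQuotient ψ ρ)),
      IsLocalDiffeomorph (IK.prod (IG.prod 𝓘(ℝ, EuclideanSpace ℝ (Fin n))))
        (IK.prod (IG.prod 𝓘(ℝ, EuclideanSpace ℝ (Fin n)))) ∞ (LatticeQuotient.mk ψ ρ) ∧
      ∃ S : GeneralizedKahlerStructure
          (IK.prod (IG.prod 𝓘(ℝ, EuclideanSpace ℝ (Fin n)))) (LatticeQuotient ψ ρ),
        PullsBackMetric (LatticeQuotient.mk ψ ρ)
          (prodBilin gJ.metric.inner (prodBilin b.inner (euclideanBilin n)))
          S.plus.metric.inner ∧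
        Intertwines (LatticeQuotient.mk ψ ρ) (prodEnd gJ.J JR) S.plus.J ∧
        Intertwines (LatticeQuotient.mk ψ ρ) (prodEnd gJ.J JL) S.minus.J := by
  have := Manifold.locallyCompact_of_finiteDimensional (M := K) IK
  have := Manifold.locallyCompact_of_finiteDimensional (M := G) IG
  have hψ m : ContMDiff IK IK ∞ (ψ m : Equiv.Perm K) := (ψ m).2.1.1
  have hρ m : ContMDiff IG IG ∞ (ρ m : Equiv.Perm G) := (ρ m).2.1
  obtain ⟨hT2, hsecond, hlocal⟩ := latticeQuotient_topology (ψ := ψ) (ρ := ρ)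
    (fun m => (hψ m).continuous) fun m => (hρ m).continuous
  have hsurj := latticeQuotient_mk_surjective ψ ρ
  obtain ⟨charts, hmanifold, hdiffeo⟩ := exists_isManifold_quotient hlocal
    (isDeckTransitive_latticeQuotient_mk hψ hρ fun _ => trivial) hsurj
  refine ⟨⟨eq_one_of_latticeAction_smul_eq ψ ρ, properlyDiscontinuousSMul_latticeAction ψ ρ⟩,
    hT2, hsecond, charts, hmanifold, hdiffeo, ?_⟩
  have hψ' m : MDifferentiable IK IK (ψ m : Equiv.Perm K) := (hψ m).mdifferentiable (by simp)
  have hρ' m : MDifferentiable IG IG (ρ m : Equiv.Perm G) := (hρ m).mdifferentiable (by simp)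
  have hshift (m : Multiplicative (Fin n → ℤ)) :
      MDifferentiable 𝓘(ℝ, EuclideanSpace ℝ (Fin n)) 𝓘(ℝ, EuclideanSpace ℝ (Fin n))
        fun t => t + latticeVec m := (differentiable_id.add_const _).mdifferentiable
  exact exists_generalizedKahlerStructure_of_isDeckTransitive hdiffeo hsurj
    (gJ.prodGeneralizedKahler hKahler
      (.ofInvariantProd hb hJL hJR hJLg hJRg hJLinv hJRinv))
    (isDeckTransitive_latticeQuotient_mk hψ hρ fun m =>
      ⟨.prodMap (hψ' m) ((hρ' m).prodMap (hshift m)) (ψ m).2.1.2.2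
          (.prodMap (hρ' m) (hshift m) (ρ m).2.2.2 (pullsBackMetric_add_const _)),
        .prodMap (hψ' m) ((hρ' m).prodMap (hshift m)) (ψ m).2.2 (hρR m),
        .prodMap (hψ' m) ((hρ' m).prodMap (hshift m)) (ψ m).2.2 (hρL m)⟩)

theorem mainTheorem8
    -- the compact Kähler manifold `(K, g, J)`
    {EK : Type*} [NormedAddCommGroup EK] [NormedSpace ℝ EK] [FiniteDimensional ℝ EK]
    {K : Type*} [TopologicalSpace K] [ChartedSpace EK K] [IsManifold 𝓘(ℝ, EK) ∞ K]
    [T2Space K] [CompactSpace K]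
    (gJ : HermitianStructure 𝓘(ℝ, EK) K) (hKahler : gJ.IsKahler)
    -- the compact, simply connected, semisimple Lie group `G` with bi-invariant metric `b`
    {EG : Type*} [NormedAddCommGroup EG] [NormedSpace ℝ EG] [FiniteDimensional ℝ EG]
    {G : Type*} [TopologicalSpace G] [ChartedSpace EG G] [Group G] [LieGroup 𝓘(ℝ, EG) ∞ G]
    [T2Space G] [CompactSpace G] [SimplyConnectedSpace G]
    (hss : IsSemisimpleLieGroup 𝓘(ℝ, EG) G) (hdim : 3 ≤ Module.finrank ℝ EG)
    (b : SmoothMetric 𝓘(ℝ, EG) G) (hb : IsBiInvariantMetric 𝓘(ℝ, EG) b.inner)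
    -- the complex structures `J_L` and `J_R` on `G' = G × ℝⁿ`, compatible with `g' = b + g_E`
    (n : ℕ)
    (JL JR : EndField (𝓘(ℝ, EG).prod 𝓘(ℝ, EuclideanSpace ℝ (Fin n)))
      (G × EuclideanSpace ℝ (Fin n)))
    (hJL : IsComplexStructure JL) (hJR : IsComplexStructure JR)
    (hJLg : IsCompatible (prodBilin b.inner (euclideanBilin n)) JL)
    (hJRg : IsCompatible (prodBilin b.inner (euclideanBilin n)) JR)
    (hJLinv : IsLeftInvariant JL) (hJRinv : IsRightInvariant JR)
    -- the homomorphisms `ψ : ℤⁿ → Isom_hol(K)` and `ρ : ℤⁿ → Isom(G)`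
    (ψ : Multiplicative (Fin n → ℤ) →* holIsomGroup gJ)
    (ρ : Multiplicative (Fin n → ℤ) →* isomGroup b)
    (hρL : ∀ m, Intertwines
      (fun x : G × EuclideanSpace ℝ (Fin n) => ((ρ m : Equiv.Perm G) x.1, x.2 + latticeVec m))
      JL JL)
    (hρR : ∀ m, Intertwines
      (fun x : G × EuclideanSpace ℝ (Fin n) => ((ρ m : Equiv.Perm G) x.1, x.2 + latticeVec m))
      JR JR) :
    -- the action is free and properly discontinuous
    (letI := latticeAction ψ ρ;
      (∀ (m : Multiplicative (Fin n → ℤ)) (x : K × G × EuclideanSpace ℝ (Fin n)),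
        m • x = x → m = 1) ∧
      ProperlyDiscontinuousSMul (Multiplicative (Fin n → ℤ))
        (K × G × EuclideanSpace ℝ (Fin n))) ∧
    -- the quotient is a smooth manifold, locally diffeomorphic to `K × G × ℝⁿ` by the projection
    T2Space (LatticeQuotient ψ ρ) ∧ SecondCountableTopology (LatticeQuotient ψ ρ) ∧
    ∃ (_ : ChartedSpace (ModelProd EK (ModelProd EG (EuclideanSpace ℝ (Fin n))))
        (LatticeQuotient ψ ρ))
      (_ : IsManifold (𝓘(ℝ, EK).prod (𝓘(ℝ, EG).prod 𝓘(ℝ, EuclideanSpace ℝ (Fin n)))) ∞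
        (LatticeQuotient ψ ρ)),
      IsLocalDiffeomorph (𝓘(ℝ, EK).prod (𝓘(ℝ, EG).prod 𝓘(ℝ, EuclideanSpace ℝ (Fin n))))
        (𝓘(ℝ, EK).prod (𝓘(ℝ, EG).prod 𝓘(ℝ, EuclideanSpace ℝ (Fin n)))) ∞
        (LatticeQuotient.mk ψ ρ) ∧
      -- it has a generalized Kähler structure induced by `g + b + g_E`, `J × J_R` and `J × J_L`
      ∃ S : GeneralizedKahlerStructure
          (𝓘(ℝ, EK).prod (𝓘(ℝ, EG).prod 𝓘(ℝ, EuclideanSpace ℝ (Fin n)))) (LatticeQuotient ψ ρ),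
        PullsBackMetric (LatticeQuotient.mk ψ ρ)
          (prodBilin gJ.metric.inner (prodBilin b.inner (euclideanBilin n)))
          S.plus.metric.inner ∧
        Intertwines (LatticeQuotient.mk ψ ρ) (prodEnd gJ.J JR) S.plus.J ∧
        Intertwines (LatticeQuotient.mk ψ ρ) (prodEnd gJ.J JL) S.minus.J := by
  have := ChartedSpace.secondCountable_of_sigmaCompact EK K
  have := ChartedSpace.secondCountable_of_sigmaCompact EG G
  exact mainTheorem8_general gJ hKahler b hb n JL JR hJL hJR hJLg hJRg hJLinv hJRinv ψ ρ hρL hρR
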